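/- **Setting.** Let $d\ge 1$, $p\ge 0$, let $\mathcal U\subset\mathbb R^p$ be an open set of admissible states, and let $f_1,\dots,f_d\colon\mathcal U\to\mathbb R^p$ be $C^1$ fluxes of the system of conservation laws $\partial_t\omega+\nabla\cdot f(\omega)=0$, where $\nabla\cdot f(\omega)=\sum_i\partial_{x_i}f_i(\omega)$. Let $(s,f^\epsilon)$ be an entropy pair: $s\colon\mathcal U\to\mathbb R$ is convex (so $\mathcal U$ is convex) and $C^1$, $f^\epsilon\colon\mathcal U\to\mathbb R^d$ is $C^1$, and $Df^\epsilon_i(\omega)=w(\omega)^TDf_i(\omega)$ for all $i$ and all $\omega\in\mathcal U$, where $w=\partial s/\partial\omega$ are the entropy variables; write $w_u=w(u)$, $w_v=w(v)$. Let $\Omega_u$ (overset domain) and $\Omega_v$ (base domain) be bounded open subsets of $\mathbb R^d$ with Lipschitz boundaries and $\partial\Omega_u\cap\partial\Omega_v=\emptyset$, and let $\Omega=\Omega_u\cup\Omega_v$. Put $\Omega_O=\Omega_u\cap\Omega_v$, $\Omega_{\bar u}=\Omega_u\setminus\overline{\Omega_v}$, $\Omega_{\bar v}=\Omega_v\setminus\overline{\Omega_u}$.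 The physical boundaries are $\Gamma_a=\partial\Omega_u\setminus\Omega_v$ and $\Gamma_d=\partial\Omega_v\setminus\Omega_u$; the artificial interfaces are $\Gamma_b=\partial\Omega_v\cap\Omega_u$ and $\Gamma_c=\partial\Omega_u\cap\Omega_v$. The unit normals $\hat n_a,\hat n_c$ are exterior to $\Omega_u$, and $\hat n_b,\hat n_d$ are exterior to $\Omega_v$; $dS$ is surface measure. Fix $0<\eta<1$ and $T>0$. On each interface $\Gamma_\alpha$, $\alpha\in\{b,c\}$, let penalty functions $\mathcal P_u^\alpha(u,v),\mathcal P_v^\alpha(u,v)\in\mathbb R^p$ be given, which may depend on the position on $\Gamma_\alpha$ and vanish for $u=v$. A *smooth solution of the overset problem* on $[0,T]$ is a pair of $\mathcal U$-valued functions $u$ on $[0,T]\times\overline{\Omega_u}$ and $v$ on $[0,T]\times\overline{\Omega_v}$, continuous there and $C^1$ on $(0,T)\times\overline{\Omega_u}$ and $(0,T)\times\overline{\Omega_v}$ respectively, such that for each $0<t<T$ the functions $\mathcal P_u^\alpha(u,v),\mathcal P_v^\alpha(u,v)$ are integrable on $\Gamma_\alpha$ and $$\int_{\Omega_{\bar u}}\phi_u^Tr_u\,dx+\int_{\Omega_O}\big((1-\eta)\phi_u^Tr_u+\eta\,\phi_v^Tr_v\big)dx+\int_{\Omega_{\bar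 v}}\phi_v^Tr_v\,dx+\sum_{\alpha=b,c}\int_{\Gamma_\alpha}\big(\phi_u^T\mathcal P^\alpha_u+\phi_v^T\mathcal P^\alpha_v\big)dS=0$$ for all test pairs $(\phi_u,\phi_v)\in\mathcal V$, where $r_u=\partial_tu+\nabla\cdot f(u)$ and $r_v=\partial_tv+\nabla\cdot f(v)$. Here the test space $\mathcal V$ is any linear space of pairs of $\mathbb R^p$-valued functions, continuous on $\overline{\Omega_u}$ and on $\overline{\Omega_v}$ respectively, that contains the pair $(w_u,w_v)$ at each time $0<t<T$; the space of all such continuous pairs is one choice. The overset entropy $S$ equals $s(u)$ on $\Omega_{\bar u}$, $(1-\eta)s(u)+\eta s(v)$ on $\Omega_O$, and $s(v)$ on $\Omega_{\bar v}$; the total entropy is $\bar S(t)=\int_\Omega S\,dx$. The physical boundary entropy flux is $$\Phi(t)=\int_{\Gamma_a}f^\epsilon(u)\cdot\hat n_a\,dS+\int_{\Gamma_d}f^\epsilon(v)\cdot\hat n_d\,dS .$$ On each interface put $$\mathcal B=\big(f^\epsilon(u)-f^\epsilon(v)\big)\cdot\vec\beta+w_u^T\mathcal P_u+w_v^T\mathcal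 P_v,\qquad \vec\beta=\begin{cases}-\eta\,\hat n_b&\text{on }\Gamma_b,\\(1-\eta)\,\hat n_c&\text{on }\Gamma_c.\end{cases}$$ **Theorem 1.** Let $(u,v)$ be a smooth solution of the overset problem. Then $\Phi$ is integrable on $[0,T]$, and the following hold. (i) If $\mathcal B\ge0$ almost everywhere on $\Gamma_b$ and on $\Gamma_c$ for all $0<t<T$, then the total entropy is bounded by initial and physical boundary data: $\bar S$ is differentiable on $(0,T)$, $$\frac{d\bar S}{dt}(t)\le-\Phi(t)\quad(0<t<T),\qquad \bar S(t)\le\bar S(0)-\int_0^t\Phi(\tau)\,d\tau\quad(0\le t\le T).$$ (ii) If the overset problem is entropy preserving, that is, $\mathcal B=0$ almost everywhere on $\Gamma_b$ and on $\Gamma_c$ for all $0<t<T$, then $$\frac{d\bar S}{dt}(t)=-\Phi(t)\quad(0<t<T),\qquad \bar S(t)=\bar S(0)-\int_0^t\Phi(\tau)\,d\tau\quad(0\le t\le T).$$ -/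

import Mathlib

open MeasureTheory Set Filter
open scoped Topology NNReal

namespace Overset

/-! ### Space, state space and the conservation law -/

/-- Physical space `ℝ^d` with `d = n + 1 ≥ 1` (the case `n = 0` is one space dimension). -/
abbrev Space (n : ℕ) := EuclideanSpace ℝ (Fin (n + 1))

/-- The space `ℝ^p` of state vectors. -/
abbrev State (p : ℕ) := EuclideanSpace ℝ (Fin p)

/-- A system of `p` conservation laws `∂ₜ ω + ∑ᵢ ∂ᵢ fᵢ(ω) = 0` in `d = n + 1` space dimensions,
with `C¹` fluxes on an open set of admissible states. -/
structure ConservationLaw (n p : ℕ) where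
  /-- the admissible states -/
  admissible : Set (State p)
  isOpen_admissible : IsOpen admissible
  /-- the `i`-th component `fᵢ` of the flux -/
  flux : Fin (n + 1) → State p → State p
  flux_contDiffOn : ∀ i, ContDiffOn ℝ 1 (flux i) admissible

/-- The entropy variables `w(ω) = ∂s/∂ω`. -/
noncomputable def entropyVariables {p : ℕ} (s : State p → ℝ) (ω : State p) : State p :=
  gradient s ω

/-- `(s, fε)` is an entropy pair: `s` is a convex scalar function of the state, `fε` a space vector,
and `D fεᵢ(ω) = w(ω)ᵀ D fᵢ(ω)` for each coordinate direction `i`. -/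
structure IsEntropyPair {n p : ℕ} (law : ConservationLaw n p)
    (s : State p → ℝ) (fε : State p → Space n) : Prop where
  convexOn : ConvexOn ℝ law.admissible s
  entropy_contDiffOn : ContDiffOn ℝ 1 s law.admissible
  entropyFlux_contDiffOn : ContDiffOn ℝ 1 fε law.admissible
  contraction : ∀ ω ∈ law.admissible, ∀ (i : Fin (n + 1)) (h : State p),
    fderiv ℝ (fun ω' => fε ω' i) ω h =
      inner ℝ (entropyVariables s ω) (fderiv ℝ (law.flux i) ω h)

/-- `∂ₜ u + ∇ₓ · f(u)` at time `t` and position `x`. -/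
noncomputable def residual {n p : ℕ} (law : ConservationLaw n p)
    (u : ℝ → Space n → State p) (t : ℝ) (x : Space n) : State p :=
  deriv (fun τ => u τ x) t +
    ∑ i, fderiv ℝ (fun y => law.flux i (u t y)) x (EuclideanSpace.single i 1)

/-! ### Domains and normals -/

/-- `Ω` has Lipschitz boundary: near each boundary point and in suitable Cartesian coordinates,
`Ω` is the region strictly below the graph of a Lipschitz function. -/
def HasLipschitzBoundary {n : ℕ} (Ω : Set (Space n)) : Prop :=
  ∀ x ∈ frontier Ω,
    ∃ (L : WithLp 2 (EuclideanSpace ℝ (Fin n) × ℝ) ≃ₗᵢ[ℝ] Space n)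
      (g : EuclideanSpace ℝ (Fin n) → ℝ) (K : ℝ≥0),
      LipschitzWith K g ∧ ∀ᶠ y in 𝓝 x, (y ∈ Ω ↔ (L.symm y).snd < g (L.symm y).fst)

/-- `ν` is the exterior unit normal of `Ω` at `x`: to first order at `x`, the set `Ω` is the
half-space of the points `y` with `(y - x) · ν < 0`. Such a `ν` is unique if it exists. -/
def IsOutwardUnitNormal {n : ℕ} (Ω : Set (Space n)) (x ν : Space n) : Prop :=
  ‖ν‖ = 1 ∧ ∀ ε > 0, ∀ᶠ y in 𝓝 x,
    (inner ℝ (y - x) ν < -(ε * ‖y - x‖) → y ∈ Ω) ∧ (ε * ‖y - x‖ < inner ℝ (y - x) ν → y ∉ Ω)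

open Classical in
/-- The exterior unit normal `n̂` of `Ω` (`0` at points where there is none). -/
noncomputable def outwardNormal {n : ℕ} (Ω : Set (Space n)) (x : Space n) : Space n :=
  if h : ∃ ν, IsOutwardUnitNormal Ω x ν then h.choose else 0

/-- Surface measure on a hypersurface `Γ`: `(d-1)`-dimensional Hausdorff measure, normalized so that
it is `(d-1)`-dimensional Lebesgue measure on hyperplanes. -/
noncomputable def surface {n : ℕ} (Γ : Set (Space n)) : Measure (Space n) :=
  (Measure.euclideanHausdorffMeasure n).restrict Γ

/-- Two overlapping subdomains `Ωu` (overset domain) and `Ωv` (base domain) of `Ω = Ωu ∪ Ωv`: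
bounded open sets with Lipschitz boundaries that do not meet. -/
structure Geometry (n : ℕ) where
  Ωu : Set (Space n)
  Ωv : Set (Space n)
  isOpen_u : IsOpen Ωu
  isOpen_v : IsOpen Ωv
  isBounded_u : Bornology.IsBounded Ωu
  isBounded_v : Bornology.IsBounded Ωv
  lipschitz_u : HasLipschitzBoundary Ωu
  lipschitz_v : HasLipschitzBoundary Ωv
  disjoint_frontier : Disjoint (frontier Ωu) (frontier Ωv)

namespace Geometry

variable {n : ℕ} (G : Geometry n)

/-- The whole domain `Ω`. -/
def Ω : Set (Space n) := G.Ωu ∪ G.Ωv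

/-- The overlap region `Ω_O`. -/
def overlap : Set (Space n) := G.Ωu ∩ G.Ωv

/-- The part `Ω_ū` of the overset domain outside the overlap. -/
def onlyU : Set (Space n) := G.Ωu \ closure G.Ωv

/-- The part `Ω_v̄` of the base domain outside the overlap. -/
def onlyV : Set (Space n) := G.Ωv \ closure G.Ωu

/-- Physical boundary `Γ_a` of the overset domain. -/
def Γa : Set (Space n) := frontier G.Ωu \ G.Ωv

/-- Artificial boundary `Γ_b` of the base domain, inside the overset domain. -/
def Γb : Set (Space n) := frontier G.Ωv ∩ G.Ωu

/-- Artificial boundary `Γ_c` of the overset domain, inside the base domain. -/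
def Γc : Set (Space n) := frontier G.Ωu ∩ G.Ωv

/-- Physical boundary `Γ_d` of the base domain. -/
def Γd : Set (Space n) := frontier G.Ωv \ G.Ωu

/-- `β = -η n̂_b` on `Γ_b`, where `n̂_b` is the normal exterior to the base domain. -/
noncomputable def βb (η : ℝ) (x : Space n) : Space n := -(η • outwardNormal G.Ωv x)

/-- `β = (1 - η) n̂_c` on `Γ_c`, where `n̂_c` is the normal exterior to the overset domain. -/
noncomputable def βc (η : ℝ) (x : Space n) : Space n := (1 - η) • outwardNormal G.Ωu x

end Geometry

/-! ### Penalties and the overset problem -/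

/-- The penalty functions `P_u(x; u, v)`, `P_v(x; u, v)` along a curve `Γ` (they may depend on the
position on `Γ`, e.g. through the normal); they vanish when the two states agree. -/
structure Penalty {n p : ℕ} (law : ConservationLaw n p) (Γ : Set (Space n)) where
  Pu : Space n → State p → State p → State p
  Pv : Space n → State p → State p → State p
  Pu_self : ∀ x ∈ Γ, ∀ ω ∈ law.admissible, Pu x ω ω = 0
  Pv_self : ∀ x ∈ Γ, ∀ ω ∈ law.admissible, Pv x ω ω = 0

/-- The time-dependent field `u` is admissible on the closure of `Ω` during `[0, T]`, continuous
there, and continuously differentiable in space-time up to the boundary of `Ω` for `0 < t < T`. -/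
structure IsSmoothField {n p : ℕ} (law : ConservationLaw n p) (Ω : Set (Space n)) (T : ℝ)
    (u : ℝ → Space n → State p) : Prop where
  admissible : ∀ t ∈ Icc 0 T, ∀ x ∈ closure Ω, u t x ∈ law.admissible
  continuousOn : ContinuousOn (Function.uncurry u) (Icc 0 T ×ˢ closure Ω)
  contDiffOn : ContDiffOn ℝ 1 (Function.uncurry u) (Ioo 0 T ×ˢ closure Ω)

/-- The weak form of the overset problem at time `t`, tested with the pair `φ = (φ_u, φ_v)`:
`⟨Φ, ∂ₜ U⟩_Ω + ⟨Φ, ∇ · F⟩_Ω + ∫_{Γ_b} Φᵀ P^b + ∫_{Γ_c} Φᵀ P^c = 0`,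
where `Φ` is `(φ_u, 0)`, `((1 - η) φ_u, η φ_v)`, `(0, φ_v)` on `Ω_ū`, `Ω_O`, `Ω_v̄` and the interface
penalties enter without overlap weights. -/
def WeakForm {n p : ℕ} (law : ConservationLaw n p) (G : Geometry n) (η : ℝ)
    (Pb : Penalty law G.Γb) (Pc : Penalty law G.Γc) (u v : ℝ → Space n → State p) (t : ℝ)
    (φ : (Space n → State p) × (Space n → State p)) : Prop :=
  (∫ x in G.onlyU, inner ℝ (φ.1 x) (residual law u t x)) +
  (∫ x in G.overlap, ((1 - η) * inner ℝ (φ.1 x) (residual law u t x) +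
    η * inner ℝ (φ.2 x) (residual law v t x))) +
  (∫ x in G.onlyV, inner ℝ (φ.2 x) (residual law v t x)) +
  (∫ x, (inner ℝ (φ.1 x) (Pb.Pu x (u t x) (v t x)) +
    inner ℝ (φ.2 x) (Pb.Pv x (u t x) (v t x))) ∂(surface G.Γb)) +
  (∫ x, (inner ℝ (φ.1 x) (Pc.Pu x (u t x) (v t x)) +
    inner ℝ (φ.2 x) (Pc.Pv x (u t x) (v t x))) ∂(surface G.Γc)) = 0

/-- `(u, v)` is a smooth solution of the overset problem on `[0, T]` with respect to the space `𝒱`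
of test pairs. The test space is any linear space of pairs that are continuous up to the boundary
and that contains the pair of entropy variables of the solution at each time; the space of all
pairs that are continuous up to the boundary is one choice. -/
structure IsSolution {n p : ℕ} (law : ConservationLaw n p) (s : State p → ℝ) (G : Geometry n)
    (η : ℝ) (Pb : Penalty law G.Γb) (Pc : Penalty law G.Γc) (T : ℝ)
    (𝒱 : Submodule ℝ ((Space n → State p) × (Space n → State p)))
    (u v : ℝ → Space n → State p) : Prop where
  smooth_u : IsSmoothField law G.Ωu T u
  smooth_v : IsSmoothField law G.Ωv T v
  integrable_Pbu : ∀ t ∈ Ioo 0 T,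
    Integrable (fun x => Pb.Pu x (u t x) (v t x)) (surface G.Γb)
  integrable_Pbv : ∀ t ∈ Ioo 0 T,
    Integrable (fun x => Pb.Pv x (u t x) (v t x)) (surface G.Γb)
  integrable_Pcu : ∀ t ∈ Ioo 0 T,
    Integrable (fun x => Pc.Pu x (u t x) (v t x)) (surface G.Γc)
  integrable_Pcv : ∀ t ∈ Ioo 0 T,
    Integrable (fun x => Pc.Pv x (u t x) (v t x)) (surface G.Γc)
  test_continuousOn : ∀ φ ∈ 𝒱,
    ContinuousOn φ.1 (closure G.Ωu) ∧ ContinuousOn φ.2 (closure G.Ωv)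
  entropyVariables_mem : ∀ t ∈ Ioo 0 T,
    ((fun x => entropyVariables s (u t x)), (fun x => entropyVariables s (v t x))) ∈ 𝒱
  weakForm : ∀ t ∈ Ioo 0 T, ∀ φ ∈ 𝒱, WeakForm law G η Pb Pc u v t φ

/-! ### Entropy of the overset problem -/

open Classical in
/-- The overset entropy `S(u, v)` at time `t`: `s(u)` on `Ω_ū`, `(1 - η) s(u) + η s(v)` on `Ω_O`,
`s(v)` on `Ω_v̄`. (The values on the null set `Γ_b ∪ Γ_c` are immaterial.) -/
noncomputable def oversetEntropy {n p : ℕ} (s : State p → ℝ) (G : Geometry n) (η : ℝ)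
    (u v : ℝ → Space n → State p) (t : ℝ) (x : Space n) : ℝ :=
  if x ∈ G.overlap then (1 - η) * s (u t x) + η * s (v t x)
  else if x ∈ G.Ωu then s (u t x) else s (v t x)

/-- The total entropy `S̄(t) = ∫_Ω S dx`. -/
noncomputable def totalEntropy {n p : ℕ} (s : State p → ℝ) (G : Geometry n) (η : ℝ)
    (u v : ℝ → Space n → State p) (t : ℝ) : ℝ :=
  ∫ x in G.Ω, oversetEntropy s G η u v t x

/-- The entropy flux through the physical boundary,
`∫_{Γ_a} fε(u) · n̂_a dS + ∫_{Γ_d} fε(v) · n̂_d dS`. -/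
noncomputable def physicalFlux {n p : ℕ} (fε : State p → Space n) (G : Geometry n)
    (u v : ℝ → Space n → State p) (t : ℝ) : ℝ :=
  (∫ x, inner ℝ (fε (u t x)) (outwardNormal G.Ωu x) ∂(surface G.Γa)) +
  (∫ x, inner ℝ (fε (v t x)) (outwardNormal G.Ωv x) ∂(surface G.Γd))

/-- The interface integrand `B = (fε(u) - fε(v)) · β + w_uᵀ P_u + w_vᵀ P_v` at time `t` and position
`x` on the interface `Γ`. -/
noncomputable def interfaceIntegrand {n p : ℕ} {law : ConservationLaw n p} {Γ : Set (Space n)}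
    (s : State p → ℝ) (fε : State p → Space n) (β : Space n → Space n) (P : Penalty law Γ)
    (u v : ℝ → Space n → State p) (t : ℝ) (x : Space n) : ℝ :=
  inner ℝ (fε (u t x) - fε (v t x)) (β x) +
    inner ℝ (entropyVariables s (u t x)) (P.Pu x (u t x) (v t x)) +
    inner ℝ (entropyVariables s (v t x)) (P.Pv x (u t x) (v t x))

/-- `B ≥ 0` on each interface. -/
def InterfaceNonneg {n p : ℕ} {law : ConservationLaw n p} (s : State p → ℝ)
    (fε : State p → Space n) (G : Geometry n) (η : ℝ)
    (Pb : Penalty law G.Γb) (Pc : Penalty law G.Γc) (T : ℝ)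
    (u v : ℝ → Space n → State p) : Prop :=
  ∀ t ∈ Ioo 0 T,
    (∀ᵐ x ∂(surface G.Γb), 0 ≤ interfaceIntegrand s fε (G.βb η) Pb u v t x) ∧
    (∀ᵐ x ∂(surface G.Γc), 0 ≤ interfaceIntegrand s fε (G.βc η) Pc u v t x)

/-- The overset problem is entropy preserving: `B = 0` on each interface. -/
def EntropyPreserving {n p : ℕ} {law : ConservationLaw n p} (s : State p → ℝ)
    (fε : State p → Space n) (G : Geometry n) (η : ℝ)
    (Pb : Penalty law G.Γb) (Pc : Penalty law G.Γc) (T : ℝ)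
    (u v : ℝ → Space n → State p) : Prop :=
  ∀ t ∈ Ioo 0 T,
    (∀ᵐ x ∂(surface G.Γb), interfaceIntegrand s fε (G.βb η) Pb u v t x = 0) ∧
    (∀ᵐ x ∂(surface G.Γc), interfaceIntegrand s fε (G.βc η) Pc u v t x = 0)

end Overset

namespace Overset

open Module (finrank)
open scoped ENNReal

/-! ### The area formula for distance-expanding Lipschitz maps -/

section AreaFormula

set_option linter.unusedSectionVars false

/-! Test the weak form with the entropy variables `(w_u, w_v)`. The contraction property of the
entropy pair turns `w_uᵀ r_u` into `∂ₜ s(u) + ∇ · fε(u)`, and likewise for `v`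
(`IsEntropyPair.inner_residual`); the divergence theorem then yields an entropy balance on each
Lipschitz domain (`IsEntropyPair.balance`). It is applied to `u` on `Ωu` and on the overlap, and to
`v` on `Ωv` and on the overlap. With coefficients `1, -η, 1, -(1 - η)` the four entropies add up to
the total entropy, and the four residual integrals to the volume part of the weak form.

The frontiers are `Γa ∪ Γc`, `Γd ∪ Γb` and, for the overlap, `Γb ∪ Γc`. In the same combination the
fluxes leave `Φ` on the physical boundary, `-η (fε(u) - fε(v)) · n̂_b` on `Γb` and `(1 - η) (fε(u) -
fε(v)) · n̂_c` on `Γc`. Together with the penalties the interface terms are exactly `B`, so the rate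
of change of the total entropy is `-Φ - ∫ B` (`IsSolution.hasDerivAt_totalEntropy`). The sign of `B`
gives the differential statements, and continuity on `[0, T]` allows integration in time.

Most of the work is the divergence theorem for bounded Lipschitz domains, with Hausdorff measure as
surface measure and the normal defined pointwise. A partition of unity reduces it to the region
below a Lipschitz graph. There a volume-preserving shear flattens the graph, and a constant vector
splits into a part tangential to the graph, whose contribution integrates to zero, and a vertical
part, which the fundamental theorem of calculus turns into boundary values. The result is an
integral over the parameter domain. It is the surface integral by the area formula `dS = √(1 +
|∇g|²) dy` and the formula `(-∇g, 1) / √(1 + |∇g|²)` for the normal, valid almost everywhere by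
Rademacher's theorem. -/

theorem euclideanHausdorffMeasure_image_le_of_lipschitzOnWith {X Y : Type*} [EMetricSpace X]
    [MeasurableSpace X] [BorelSpace X] [EMetricSpace Y] [MeasurableSpace Y] [BorelSpace Y]
    {f : X → Y} {s : Set X} {K : ℝ≥0} (hf : LipschitzOnWith K f s) (d : ℕ) :
    Measure.euclideanHausdorffMeasure d (f '' s) ≤
      (K : ℝ≥0∞) ^ d * Measure.euclideanHausdorffMeasure d s := by
  simp only [Measure.euclideanHausdorffMeasure_def, Measure.smul_apply, ENNReal.smul_def,
    smul_eq_mul]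
  rw [mul_left_comm]
  gcongr
  simpa using hf.hausdorffMeasure_image_le (Nat.cast_nonneg d)

/-- The hypothesis makes `f` factor through `g` on `s` by a `K`-Lipschitz map of `g '' s`. This
compares a map directly with its linear approximation. -/
theorem euclideanHausdorffMeasure_image_le_image {X Y Z : Type*} [Nonempty X]
    [MetricSpace Y] [MeasurableSpace Y] [BorelSpace Y] [MetricSpace Z] [MeasurableSpace Z]
    [BorelSpace Z] {f : X → Y} {g : X → Z} {s : Set X} {K : ℝ≥0}
    (h : ∀ x ∈ s, ∀ y ∈ s, dist (f x) (f y) ≤ K * dist (g x) (g y)) (d : ℕ) :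
    Measure.euclideanHausdorffMeasure d (f '' s) ≤
      (K : ℝ≥0∞) ^ d * Measure.euclideanHausdorffMeasure d (g '' s) := by
  have hinv : ∀ x ∈ s, Function.invFunOn g s (g x) ∈ s ∧ g (Function.invFunOn g s (g x)) = g x :=
    fun x hx => ⟨Function.invFunOn_mem ⟨x, hx, rfl⟩, Function.invFunOn_eq ⟨x, hx, rfl⟩⟩
  have himg : f '' s = (f ∘ Function.invFunOn g s) '' (g '' s) := by
    rw [image_image]
    refine image_congr fun x hx => ?_
    have := h x hx _ (hinv x hx).1
    rw [(hinv x hx).2, dist_self, mul_zero] at this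
    exact dist_le_zero.1 this
  rw [himg]
  refine euclideanHausdorffMeasure_image_le_of_lipschitzOnWith
    (LipschitzOnWith.of_dist_le_mul ?_) d
  rintro _ ⟨x, hx, rfl⟩ _ ⟨y, hy, rfl⟩
  have := h _ (hinv x hx).1 _ (hinv y hy).1
  rwa [(hinv x hx).2, (hinv y hy).2] at this

variable {U V : Type*} [NormedAddCommGroup U] [InnerProductSpace ℝ U] [FiniteDimensional ℝ U]
  [MeasurableSpace U] [BorelSpace U] [NormedAddCommGroup V] [InnerProductSpace ℝ V]
  [FiniteDimensional ℝ V] [MeasurableSpace V] [BorelSpace V]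

/-- Nearby expanding linear maps have nearby Jacobians. -/
theorem normDet_le_of_norm_sub_le {A B : U →L[ℝ] V} {δ : ℝ≥0} (hB : ∀ v, ‖v‖ ≤ ‖B v‖)
    (hAB : ‖A - B‖ ≤ δ) :
    ENNReal.ofReal A.toLinearMap.normDet ≤
      ((1 + δ : ℝ≥0) : ℝ≥0∞) ^ finrank ℝ U * ENNReal.ofReal B.toLinearMap.normDet := by
  -- The unit ball is merely a test set of finite positive volume, which cancels and leaves the
  -- Jacobians.
  have key := euclideanHausdorffMeasure_image_le_image (f := A) (g := B)
    (s := Metric.closedBall 0 1) (K := 1 + δ) ?_ (finrank ℝ U)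
  · have hA' := A.toLinearMap.euclideanHausdorffMeasure_image_eq_normDet_mul_volume
      (Metric.closedBall 0 1)
    have hB' := B.toLinearMap.euclideanHausdorffMeasure_image_eq_normDet_mul_volume
      (Metric.closedBall 0 1)
    simp only [ContinuousLinearMap.coe_coe] at hA' hB'
    rw [hA', hB', ← mul_assoc] at key
    refine (ENNReal.mul_le_mul_iff_left ?_ ?_).1 key
    · exact (Metric.measure_closedBall_pos _ _ one_pos).ne'
    · exact measure_closedBall_lt_top.ne
  · intro x _ y _
    rw [dist_eq_norm, dist_eq_norm, ← map_sub, ← map_sub]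
    calc ‖A (x - y)‖ = ‖B (x - y) + (A - B) (x - y)‖ := by simp
      _ ≤ ‖B (x - y)‖ + δ * ‖x - y‖ :=
        (norm_add_le _ _).trans (add_le_add le_rfl ((A - B).le_of_opNorm_le hAB _))
      _ ≤ ‖B (x - y)‖ + δ * ‖B (x - y)‖ := by gcongr; exact hB _
      _ = ((1 + δ : ℝ≥0) : ℝ) * ‖B (x - y)‖ := by push_cast; ring

variable {f : U → V}

/-- Since `A` is expanding, the additive error `δ * ‖x - y‖` is absorbed as a factor `1 + δ`, and
the measure of the linear image is known exactly. -/
theorem euclideanHausdorffMeasure_image_le_of_approximatesLinearOn {A : U →L[ℝ] V} {δ : ℝ≥0}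
    {s : Set U} (hA : ∀ v, ‖v‖ ≤ ‖A v‖) (hfA : ApproximatesLinearOn f A s δ) :
    Measure.euclideanHausdorffMeasure (finrank ℝ U) (f '' s) ≤
      ((1 + δ : ℝ≥0) : ℝ≥0∞) ^ finrank ℝ U *
        (ENNReal.ofReal A.toLinearMap.normDet * volume s) := by
  have hA' := A.toLinearMap.euclideanHausdorffMeasure_image_eq_normDet_mul_volume s
  rw [← hA']
  refine euclideanHausdorffMeasure_image_le_image (g := A) ?_ _
  intro x hx y hy
  rw [dist_eq_norm, dist_eq_norm, ← map_sub]
  calc ‖f x - f y‖ = ‖A (x - y) + (f x - f y - A (x - y))‖ := by simp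
    _ ≤ ‖A (x - y)‖ + δ * ‖x - y‖ :=
      (norm_add_le _ _).trans (add_le_add le_rfl (hfA x hx y hy))
    _ ≤ ‖A (x - y)‖ + δ * ‖A (x - y)‖ := by gcongr; exact hA _
    _ = ((1 + δ : ℝ≥0) : ℝ) * ‖A (x - y)‖ := by push_cast; ring

/-- The roles are exchanged: here the expansion of `f` itself absorbs the error. -/
theorem le_euclideanHausdorffMeasure_image_of_approximatesLinearOn {A : U →L[ℝ] V} {δ : ℝ≥0}
    {s : Set U} (hf : ∀ x y, ‖x - y‖ ≤ ‖f x - f y‖) (hfA : ApproximatesLinearOn f A s δ) :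
    ENNReal.ofReal A.toLinearMap.normDet * volume s ≤
      ((1 + δ : ℝ≥0) : ℝ≥0∞) ^ finrank ℝ U *
        Measure.euclideanHausdorffMeasure (finrank ℝ U) (f '' s) := by
  have hA' := A.toLinearMap.euclideanHausdorffMeasure_image_eq_normDet_mul_volume s
  rw [← hA']
  refine euclideanHausdorffMeasure_image_le_image (f := A) ?_ _
  intro x hx y hy
  rw [dist_eq_norm, dist_eq_norm, ← map_sub]
  calc ‖A (x - y)‖ = ‖(f x - f y) - (f x - f y - A (x - y))‖ := by simp
    _ ≤ ‖f x - f y‖ + δ * ‖x - y‖ :=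
      (norm_sub_le _ _).trans (add_le_add le_rfl (hfA x hx y hy))
    _ ≤ ‖f x - f y‖ + δ * ‖f x - f y‖ := by gcongr; exact hf _ _
    _ = ((1 + δ : ℝ≥0) : ℝ) * ‖f x - f y‖ := by push_cast; ring

/-- The derivative of an expanding map is expanding. -/
theorem norm_le_norm_fderiv_of_expanding (hf : ∀ x y, ‖x - y‖ ≤ ‖f x - f y‖) {x : U}
    (hx : DifferentiableAt ℝ f x) (v : U) : ‖v‖ ≤ ‖fderiv ℝ f x v‖ := by
  have h := (hx.hasFDerivAt.hasLineDerivAt v).tendsto_slope_zero_right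
  refine ge_of_tendsto h.norm ?_
  filter_upwards [self_mem_nhdsWithin] with t (ht : 0 < t)
  have := hf (x + t • v) x
  rw [add_sub_cancel_left, norm_smul, Real.norm_of_nonneg ht.le] at this
  rw [norm_smul, norm_inv, Real.norm_of_nonneg ht.le, inv_mul_eq_div, le_div_iff₀ ht]
  linarith

variable {s : Set U}

/-- One piece of the area formula: the derivative is nearly constant and the map nearly linear. -/
theorem area_estimates_of_approximatesLinearOn {A : U →L[ℝ] V} {δ : ℝ≥0}
    (hf : ∀ x y, ‖x - y‖ ≤ ‖f x - f y‖) (hs : MeasurableSet s)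
    (hd : ∀ x ∈ s, DifferentiableAt ℝ f x) (hA : ∀ v, ‖v‖ ≤ ‖A v‖)
    (hfA : ApproximatesLinearOn f A s δ) (hclose : ∀ x ∈ s, ‖fderiv ℝ f x - A‖ ≤ δ) :
    Measure.euclideanHausdorffMeasure (finrank ℝ U) (f '' s) ≤
        ((1 + δ : ℝ≥0) : ℝ≥0∞) ^ (2 * finrank ℝ U) *
          ∫⁻ x in s, ENNReal.ofReal (fderiv ℝ f x).toLinearMap.normDet ∧
      ∫⁻ x in s, ENNReal.ofReal (fderiv ℝ f x).toLinearMap.normDet ≤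
        ((1 + δ : ℝ≥0) : ℝ≥0∞) ^ (2 * finrank ℝ U) *
          Measure.euclideanHausdorffMeasure (finrank ℝ U) (f '' s) := by
  -- One factor `c` pays for replacing `f` by `A`, a second one for replacing `A` by the derivative.
  set c : ℝ≥0∞ := ((1 + δ : ℝ≥0) : ℝ≥0∞) ^ finrank ℝ U with hc
  have hcc : ((1 + δ : ℝ≥0) : ℝ≥0∞) ^ (2 * finrank ℝ U) = c * c := by rw [two_mul, pow_add]
  have hctop : c ≠ ∞ := by simp [hc]
  rw [hcc]
  constructor
  · refine (euclideanHausdorffMeasure_image_le_of_approximatesLinearOn hA hfA).trans ?_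
    rw [mul_assoc]
    gcongr c * ?_
    rw [← lintegral_const_mul' _ _ hctop, ← setLIntegral_const]
    refine setLIntegral_mono' hs fun x hx => ?_
    exact normDet_le_of_norm_sub_le (norm_le_norm_fderiv_of_expanding hf (hd x hx))
      (by rw [norm_sub_rev]; exact hclose x hx)
  · calc ∫⁻ x in s, ENNReal.ofReal (fderiv ℝ f x).toLinearMap.normDet
        ≤ ∫⁻ _ in s, c * ENNReal.ofReal A.toLinearMap.normDet :=
          setLIntegral_mono' hs fun x hx => normDet_le_of_norm_sub_le hA (hclose x hx)
      _ = c * (ENNReal.ofReal A.toLinearMap.normDet * volume s) := by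
          rw [setLIntegral_const, mul_assoc]
      _ ≤ _ := by
          rw [mul_assoc]
          gcongr c * ?_
          exact le_euclideanHausdorffMeasure_image_of_approximatesLinearOn hf hfA

/-- Countable decomposition into pieces where the derivative is nearly constant and the map nearly
linear. -/
theorem exists_partition_fderiv_close (hs : MeasurableSet s)
    (hd : ∀ x ∈ s, DifferentiableAt ℝ f x) {δ : ℝ≥0} (hδ : 0 < δ) :
    ∃ (t : ℕ × ℕ → Set U) (A : ℕ × ℕ → U →L[ℝ] V),
      Pairwise (Function.onFun Disjoint t) ∧ (∀ i, MeasurableSet (t i)) ∧ (⋃ i, t i) = s ∧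
      ∀ i, (t i).Nonempty → ApproximatesLinearOn f (A i) (t i) δ ∧
        (∃ y ∈ s, A i = fderiv ℝ f y) ∧ ∀ x ∈ t i, ‖fderiv ℝ f x - A i‖ ≤ δ := by
  classical
  obtain ⟨B, hB⟩ := TopologicalSpace.exists_dense_seq (U →L[ℝ] V)
  -- By separability of the space of linear maps, countably many balls of radius `δ / 2` cover the
  -- values of the derivative.
  set D : ℕ → Set U := fun j => fderiv ℝ f ⁻¹' Metric.ball (B j) (δ / 2)
  have hD : ∀ j, MeasurableSet (D j) := fun j => measurable_fderiv ℝ f measurableSet_ball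
  have hDcover : ⋃ j, D j = univ := by
    refine eq_univ_of_forall fun x => ?_
    obtain ⟨j, hj⟩ := hB.exists_dist_lt (fderiv ℝ f x) (half_pos (NNReal.coe_pos.2 hδ))
    exact mem_iUnion.2 ⟨j, hj⟩
  -- Each slice is partitioned separately, so that the approximating map is a derivative at a point
  -- of the same slice and hence within `δ` of all derivatives there.
  have hpart : ∀ j, ∃ (t : ℕ → Set U) (A : ℕ → U →L[ℝ] V),
      Pairwise (Function.onFun Disjoint t) ∧ (∀ n, MeasurableSet (t n)) ∧
        (s ∩ disjointed D j ⊆ ⋃ n, t n) ∧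
          (∀ n, ApproximatesLinearOn f (A n) (s ∩ disjointed D j ∩ t n) δ) ∧
            ((s ∩ disjointed D j).Nonempty → ∀ n, ∃ y ∈ s ∩ disjointed D j,
              A n = fderiv ℝ f y) := fun j =>
    exists_partition_approximatesLinearOn_of_hasFDerivWithinAt f (s ∩ disjointed D j)
      (fderiv ℝ f) (fun x hx => (hd x hx.1).hasFDerivAt.hasFDerivWithinAt) (fun _ => δ)
      fun _ => hδ.ne'
  choose t A ht htm hts htA hAy using hpart
  refine ⟨fun i => s ∩ disjointed D i.1 ∩ t i.1 i.2, fun i => A i.1 i.2, ?_, ?_, ?_, ?_⟩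
  · rintro ⟨i, k⟩ ⟨j, l⟩ hij
    by_cases h : i = j
    · subst h
      have hkl : k ≠ l := fun h => hij (by rw [h])
      exact (ht i hkl).mono inter_subset_right inter_subset_right
    · exact (disjoint_disjointed D h).mono (inter_subset_left.trans inter_subset_right)
        (inter_subset_left.trans inter_subset_right)
  · exact fun i => (hs.inter (MeasurableSet.disjointed hD i.1)).inter (htm i.1 i.2)
  · refine subset_antisymm (iUnion_subset fun i => inter_subset_left.trans inter_subset_left) ?_
    intro x hx
    have : x ∈ ⋃ j, disjointed D j := by rw [iUnion_disjointed, hDcover]; trivial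
    obtain ⟨j, hj⟩ := mem_iUnion.1 this
    obtain ⟨k, hk⟩ := mem_iUnion.1 (hts j ⟨hx, hj⟩)
    exact mem_iUnion.2 ⟨(j, k), ⟨hx, hj⟩, hk⟩
  · rintro ⟨j, k⟩ ⟨z, hz⟩
    obtain ⟨y, hy, hAeq⟩ := hAy j ⟨z, hz.1⟩ k
    refine ⟨htA j k, ⟨y, hy.1, hAeq⟩, fun x hx => ?_⟩
    have h1 : dist (fderiv ℝ f x) (B j) < δ / 2 := disjointed_subset D j hx.1.2
    have h2 : dist (fderiv ℝ f y) (B j) < δ / 2 := disjointed_subset D j hy.2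
    simp only [hAeq]
    rw [← dist_eq_norm]
    linarith [dist_triangle_right (fderiv ℝ f x) (fderiv ℝ f y) (B j)]

/-- Sum the estimates of the pieces. An expanding map is injective, so disjoint pieces have disjoint
measurable images. -/
theorem area_estimates_of_differentiable (hf : ∀ x y, ‖x - y‖ ≤ ‖f x - f y‖)
    (hs : MeasurableSet s) (hd : ∀ x ∈ s, DifferentiableAt ℝ f x) {δ : ℝ≥0} (hδ : 0 < δ) :
    Measure.euclideanHausdorffMeasure (finrank ℝ U) (f '' s) ≤
        ((1 + δ : ℝ≥0) : ℝ≥0∞) ^ (2 * finrank ℝ U) *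
          ∫⁻ x in s, ENNReal.ofReal (fderiv ℝ f x).toLinearMap.normDet ∧
      ∫⁻ x in s, ENNReal.ofReal (fderiv ℝ f x).toLinearMap.normDet ≤
        ((1 + δ : ℝ≥0) : ℝ≥0∞) ^ (2 * finrank ℝ U) *
          Measure.euclideanHausdorffMeasure (finrank ℝ U) (f '' s) := by
  obtain ⟨t, A, htd, htm, hts, hA⟩ := exists_partition_fderiv_close hs hd hδ
  have hinj : Function.Injective f := fun x y hxy => by
    have := hf x y
    rwa [hxy, sub_self, norm_zero, norm_le_zero_iff, sub_eq_zero] at this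
  have hsub : ∀ i, t i ⊆ s := fun i => hts ▸ subset_iUnion t i
  have hpiece : ∀ i, _ := fun i => (t i).eq_empty_or_nonempty.elim
    (fun h => by
      have : Measure.euclideanHausdorffMeasure (finrank ℝ U) (f '' t i) ≤
          ((1 + δ : ℝ≥0) : ℝ≥0∞) ^ (2 * finrank ℝ U) *
            ∫⁻ x in t i, ENNReal.ofReal (fderiv ℝ f x).toLinearMap.normDet ∧
        ∫⁻ x in t i, ENNReal.ofReal (fderiv ℝ f x).toLinearMap.normDet ≤
          ((1 + δ : ℝ≥0) : ℝ≥0∞) ^ (2 * finrank ℝ U) *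
            Measure.euclideanHausdorffMeasure (finrank ℝ U) (f '' t i) := by simp [h]
      exact this)
    (fun h => by
      obtain ⟨h1, ⟨y, hy, h2⟩, h3⟩ := hA i h
      exact area_estimates_of_approximatesLinearOn hf (htm i) (fun x hx => hd x (hsub i hx))
        (fun v => h2 ▸ norm_le_norm_fderiv_of_expanding hf (hd y hy) v) h1 h3)
  have himg : Measure.euclideanHausdorffMeasure (finrank ℝ U) (f '' s) =
      ∑' i, Measure.euclideanHausdorffMeasure (finrank ℝ U) (f '' t i) := by
    rw [← hts, image_iUnion]
    refine measure_iUnion (fun i j hij => ?_) fun i => ?_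
    · exact (disjoint_image_iff hinj).2 (htd hij)
    · exact (htm i).image_of_continuousOn_injOn
        (fun x hx => (hd x (hsub i hx)).continuousAt.continuousWithinAt) hinj.injOn
  have hint : ∫⁻ x in s, ENNReal.ofReal (fderiv ℝ f x).toLinearMap.normDet =
      ∑' i, ∫⁻ x in t i, ENNReal.ofReal (fderiv ℝ f x).toLinearMap.normDet := by
    rw [← hts, lintegral_iUnion htm htd]
  rw [himg, hint, ← ENNReal.tsum_mul_left, ← ENNReal.tsum_mul_left]
  exact ⟨ENNReal.tsum_le_tsum fun i => (hpiece i).1, ENNReal.tsum_le_tsum fun i => (hpiece i).2⟩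

theorem le_of_forall_one_add_pow_mul_le {a b : ℝ≥0∞} (k : ℕ)
    (h : ∀ δ : ℝ≥0, 0 < δ → a ≤ ((1 + δ : ℝ≥0) : ℝ≥0∞) ^ k * b) : a ≤ b := by
  have hlim : Tendsto (fun δ : ℝ≥0 => ((1 + δ : ℝ≥0) : ℝ≥0∞) ^ k * b) (𝓝[>] 0) (𝓝 (1 * b)) := by
    refine ENNReal.Tendsto.mul_const ?_ (Or.inl one_ne_zero)
    have h1 : Tendsto (fun δ : ℝ≥0 => (1 + δ) ^ k) (𝓝[>] 0) (𝓝 ((1 + 0) ^ k)) :=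
      ((continuous_const.add continuous_id).pow k).continuousAt.tendsto.mono_left
        nhdsWithin_le_nhds
    simpa using ENNReal.tendsto_coe.2 h1
  rw [one_mul] at hlim
  refine ge_of_tendsto hlim ?_
  filter_upwards [self_mem_nhdsWithin] with δ hδ using h δ hδ

/-- **Area formula** for expanding Lipschitz maps. -/
theorem euclideanHausdorffMeasure_image_eq_lintegral_normDet {K : ℝ≥0} (hK : LipschitzWith K f)
    (hf : ∀ x y, ‖x - y‖ ≤ ‖f x - f y‖) (hs : MeasurableSet s) :
    Measure.euclideanHausdorffMeasure (finrank ℝ U) (f '' s) =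
      ∫⁻ x in s, ENNReal.ofReal (fderiv ℝ f x).toLinearMap.normDet := by
  set D : Set U := {x | DifferentiableAt ℝ f x}
  have hDm : MeasurableSet D := measurableSet_of_differentiableAt ℝ f
  -- Rademacher's theorem; the exceptional null set has a null image because `f` is Lipschitz.
  have hDae : ∀ᵐ x : U, x ∈ D := hK.ae_differentiableAt
  have hnull : volume (s \ D) = 0 := measure_mono_null (fun x hx => hx.2) hDae
  have h1 : Measure.euclideanHausdorffMeasure (finrank ℝ U) (f '' s) =
      Measure.euclideanHausdorffMeasure (finrank ℝ U) (f '' (s ∩ D)) := by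
    refine le_antisymm ?_ (measure_mono (image_mono inter_subset_left))
    calc Measure.euclideanHausdorffMeasure (finrank ℝ U) (f '' s)
        ≤ Measure.euclideanHausdorffMeasure (finrank ℝ U) (f '' (s ∩ D) ∪ f '' (s \ D)) := by
          rw [← image_union, inter_union_sdiff]
      _ ≤ _ := measure_union_le _ _
      _ = Measure.euclideanHausdorffMeasure (finrank ℝ U) (f '' (s ∩ D)) := by
          have := euclideanHausdorffMeasure_image_le_of_lipschitzOnWith
            (hK.lipschitzOnWith (s := s \ D)) (finrank ℝ U)
          rw [InnerProductSpace.euclideanHausdorffMeasure_eq_volume, hnull, mul_zero,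
            nonpos_iff_eq_zero] at this
          rw [this, add_zero]
  have h2 : ∫⁻ x in s, ENNReal.ofReal (fderiv ℝ f x).toLinearMap.normDet =
      ∫⁻ x in s ∩ D, ENNReal.ofReal (fderiv ℝ f x).toLinearMap.normDet := by
    refine setLIntegral_congr ?_
    filter_upwards [hDae] with x hx
    exact propext ⟨fun h => ⟨h, hx⟩, fun h => h.1⟩
  rw [h1, h2]
  have key := fun (δ : ℝ≥0) (hδ : 0 < δ) =>
    area_estimates_of_differentiable hf (hs.inter hDm) (fun x hx => hx.2) hδ
  exact le_antisymm (le_of_forall_one_add_pow_mul_le _ fun δ hδ => (key δ hδ).1)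
    (le_of_forall_one_add_pow_mul_le _ fun δ hδ => (key δ hδ).2)

/-- The area formula as an identity of measures on the image. -/
theorem euclideanHausdorffMeasure_restrict_range {K : ℝ≥0} (hK : LipschitzWith K f)
    (hf : ∀ x y, ‖x - y‖ ≤ ‖f x - f y‖) :
    (Measure.euclideanHausdorffMeasure (finrank ℝ U)).restrict (range f) =
      Measure.map f (volume.withDensity
        fun x => ENNReal.ofReal (fderiv ℝ f x).toLinearMap.normDet) := by
  ext B hB
  rw [Measure.restrict_apply hB, Measure.map_apply hK.continuous.measurable hB,
    withDensity_apply _ (hK.continuous.measurable hB),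
    ← euclideanHausdorffMeasure_image_eq_lintegral_normDet hK hf (hK.continuous.measurable hB),
    image_preimage_eq_inter_range]

/-- The Jacobian of the graph of a linear form. -/
theorem normDet_graph {A : U →ₗ[ℝ] V} {w : U}
    (hA : ∀ x y, inner ℝ (A x) (A y) = inner ℝ x y + inner ℝ w x * inner ℝ w y) :
    A.normDet = √(1 + ‖w‖ ^ 2) := by
  rw [eq_comm, Real.sqrt_eq_iff_eq_sq (by positivity) A.normDet_nonneg]
  let b := stdOrthonormalBasis ℝ U
  have h := A.normDet_sq_eq_det_gram b
  rw [RCLike.ofReal_real_eq_id, id] at h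
  rw [h]
  -- In an orthonormal basis the Gram matrix is a rank-one perturbation of the identity, so the
  -- matrix determinant lemma applies.
  have : Matrix.gram ℝ (fun i => A (b i)) =
      1 + Matrix.replicateCol Unit (fun i => inner ℝ w (b i)) *
        Matrix.replicateRow Unit (fun i => inner ℝ w (b i)) := by
    ext i j
    rw [Matrix.gram_apply, hA, Matrix.add_apply, Matrix.one_apply, b.inner_eq_ite]
    simp [Matrix.mul_apply]
  rw [this, Matrix.det_one_add_replicateCol_mul_replicateRow, ← b.sum_sq_inner_left w]
  simp [dotProduct, pow_two]

end AreaFormula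

end Overset

namespace Overset

/-! ### The divergence theorem below the graph of a Lipschitz function -/

section Subgraph

set_option linter.unusedSectionVars false

variable {E : Type*} [NormedAddCommGroup E] [InnerProductSpace ℝ E] [FiniteDimensional ℝ E]
  [MeasurableSpace E] [BorelSpace E]

/-- Directional derivatives of compactly supported Lipschitz functions integrate to zero. -/
theorem integral_lineDeriv_eq_zero {f : E → ℝ} {D : ℝ≥0} (hf : LipschitzWith D f)
    (hsupp : HasCompactSupport f) (a : E) : ∫ x, lineDeriv ℝ f x a = 0 := by
  -- Integration by parts against the constant `1`; the direction `-a` offsets the sign in the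
  -- formula.
  have key := (LipschitzWith.const (1 : ℝ)).integral_lineDeriv_mul_eq
    (μ := (volume : Measure E)) hf hsupp (-a)
  have hconst : ∀ x : E, lineDeriv ℝ (fun _ : E => (1 : ℝ)) x (-a) = 0 := fun x => by
    simp [lineDeriv]
  simp only [hconst, zero_mul, integral_zero, neg_neg, mul_one] at key
  exact key.symm

/-- The shear that flattens a graph. -/
def shear {g : E → ℝ} (hg : Continuous g) : E × ℝ ≃ₜ E × ℝ where
  toFun p := (p.1, g p.1 + p.2)
  invFun p := (p.1, p.2 - g p.1)
  left_inv p := by simp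
  right_inv p := by simp
  continuous_toFun := by fun_prop
  continuous_invFun := by fun_prop

/-- On each vertical line the shear is a translation. -/
theorem measurePreserving_shear {g : E → ℝ} (hg : Continuous g) :
    MeasurePreserving (shear hg) volume volume := by
  refine MeasurePreserving.skew_product (f := id) (g := fun y r => g y + r)
    (MeasurePreserving.id _) (by fun_prop) (Eventually.of_forall fun y => ?_)
  exact (measurePreserving_add_left volume (g y)).map_eq

/-- A function of class `C¹` strictly below a Lipschitz graph, with bounded derivative, bounded
support and with boundary values on the graph. -/
structure IsSubgraphTest (g : E → ℝ) (ψ : E × ℝ → ℝ) (M B R : ℝ) : Prop where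
  differentiableAt : ∀ p : E × ℝ, p.2 < g p.1 → DifferentiableAt ℝ ψ p
  norm_fderiv_le : ∀ p : E × ℝ, p.2 < g p.1 → ‖fderiv ℝ ψ p‖ ≤ M
  bound : ∀ p : E × ℝ, p.2 < g p.1 → |ψ p| ≤ B
  eq_zero : ∀ p : E × ℝ, p.2 < g p.1 → R < ‖p‖ → ψ p = 0
  continuousWithinAt : ∀ y, ContinuousWithinAt (fun z => ψ (y, z)) (Iic (g y)) (g y)

variable {g : E → ℝ} {ψ : E × ℝ → ℝ} {M B R : ℝ} {K : ℝ≥0}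

theorem isOpen_subgraph (hg : Continuous g) : IsOpen {p : E × ℝ | p.2 < g p.1} :=
  isOpen_lt continuous_snd (hg.comp continuous_fst)

namespace IsSubgraphTest

theorem fderiv_eq_zero (hψ : IsSubgraphTest g ψ M B R) (hg : Continuous g) {p : E × ℝ}
    (hp : p.2 < g p.1) (hR : R < ‖p‖) : fderiv ℝ ψ p = 0 := by
  have : ψ =ᶠ[𝓝 p] fun _ => 0 := by
    filter_upwards [(isOpen_subgraph hg).mem_nhds hp,
      (isOpen_lt continuous_const continuous_norm).mem_nhds hR] with q hq hq'
    exact hψ.eq_zero q hq hq'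
  rw [this.fderiv_eq]
  simp

/-- Restrictions to graphs parallel to the boundary are Lipschitz. -/
theorem exists_lipschitzWith (hψ : IsSubgraphTest g ψ M B R) (hg : LipschitzWith K g) {r : ℝ}
    (hr : r < 0) : ∃ D, LipschitzWith D fun y => ψ (y, g y + r) := by
  have hM : 0 ≤ M := (norm_nonneg (fderiv ℝ ψ (0, g 0 + r))).trans (hψ.norm_fderiv_le _ (by simpa using hr))
  have hB : 0 ≤ B := (abs_nonneg _).trans (hψ.bound (0, g 0 + r) (by simpa using hr))
  -- For base points closer than `ρ`, the chord between two points of the parallel graph stays below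
  -- the graph of `g`. The slope `K` is used twice, along the chord and between its ends; the `1`
  -- keeps the denominator positive.
  set ρ : ℝ := -r / (2 * K + 1) with hρ
  have hρ0 : 0 < ρ := div_pos (by linarith) (by positivity)
  refine ⟨(M * (1 + K) + 2 * B / ρ).toNNReal, LipschitzWith.of_dist_le_mul fun y z => ?_⟩
  rw [Real.coe_toNNReal _ (by positivity), Real.dist_eq]
  have hgyz := hg.dist_le_mul y z
  rw [Real.dist_eq] at hgyz
  rcases lt_or_ge (dist y z) ρ with h | h
  · have hseg : segment ℝ (z, g z + r) (y, g y + r) ⊆ {p : E × ℝ | p.2 < g p.1} := by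
      rintro p ⟨a, b, ha, hb, hab, rfl⟩
      have h1 := hg.dist_le_mul (a • z + b • y) z
      have h2 : dist (a • z + b • y) z ≤ dist y z := by
        have : a • z + b • y - z = b • (y - z) := by
          rw [show a = 1 - b by linarith]; module
        rw [dist_eq_norm, this, norm_smul, Real.norm_of_nonneg hb, ← dist_eq_norm]
        exact mul_le_of_le_one_left dist_nonneg (by linarith)
      have h3 : K * dist y z * 2 < -r := by
        rw [hρ, lt_div_iff₀ (by positivity)] at h
        nlinarith [dist_nonneg (x := y) (y := z)]
      have h4 : (K : ℝ) * dist (a • z + b • y) z ≤ K * dist y z := by gcongr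
      rw [Real.dist_eq] at h1
      have h5 := (abs_le.1 (h1.trans h4)).1
      have h6 := (abs_le.1 hgyz).2
      have h7 : b * (g y - g z) ≤ K * dist y z :=
        (mul_le_mul_of_nonneg_left h6 hb).trans
          (mul_le_of_le_one_left (by positivity) (by linarith))
      simp only [mem_ofPred_eq, Prod.fst_add, Prod.smul_fst, Prod.snd_add, Prod.smul_snd,
        smul_eq_mul]
      have h8 : a * (g z + r) + b * (g y + r) = g z + r + b * (g y - g z) := by
        rw [show a = 1 - b by linarith]; ring
      rw [h8]
      linarith
    have key := (convex_segment (𝕜 := ℝ) (z, g z + r) (y, g y + r)).norm_image_sub_le_of_norm_hasFDerivWithin_le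
      (f := ψ) (f' := fderiv ℝ ψ) (C := M)
      (fun p hp => (hψ.differentiableAt p (hseg hp)).hasFDerivAt.hasFDerivWithinAt)
      (fun p hp => hψ.norm_fderiv_le p (hseg hp)) (left_mem_segment ℝ _ _)
      (right_mem_segment ℝ _ _)
    rw [Real.norm_eq_abs] at key
    have hn : ‖(y, g y + r) - (z, g z + r)‖ ≤ (1 + K) * dist y z := by
      rw [Prod.mk_sub_mk, add_sub_add_right_eq_sub, Prod.norm_def]
      simp only [Real.norm_eq_abs]
      refine max_le ?_ ?_
      · rw [← dist_eq_norm]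
        nlinarith [dist_nonneg (x := y) (y := z), mul_nonneg K.coe_nonneg (dist_nonneg (x := y) (y := z))]
      · nlinarith [dist_nonneg (x := y) (y := z)]
    calc |ψ (y, g y + r) - ψ (z, g z + r)| ≤ M * ((1 + K) * dist y z) :=
          key.trans (by gcongr)
      _ ≤ (M * (1 + K) + 2 * B / ρ) * dist y z := by
          rw [add_mul (M * _), mul_assoc]
          exact le_add_of_nonneg_right (by positivity)
  -- For base points at distance at least `ρ`, boundedness of `ψ` alone gives a Lipschitz bound.
  · calc |ψ (y, g y + r) - ψ (z, g z + r)| ≤ B + B :=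
          (abs_sub _ _).trans (add_le_add (hψ.bound _ (by simpa using hr))
            (hψ.bound _ (by simpa using hr)))
      _ = 2 * B / ρ * ρ := by field_simp; ring
      _ ≤ 2 * B / ρ * dist y z := by gcongr
      _ ≤ (M * (1 + K) + 2 * B / ρ) * dist y z := by
          rw [add_mul]
          exact le_add_of_nonneg_left (by positivity)

/-- Along graphs parallel to the boundary, tangential derivatives integrate to zero. -/
theorem integral_tangential_eq_zero (hψ : IsSubgraphTest g ψ M B R) (hg : LipschitzWith K g)
    {r : ℝ} (hr : r < 0) (a : E) :
    ∫ y, fderiv ℝ ψ (y, g y + r) (a, fderiv ℝ g y a) = 0 := by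
  obtain ⟨D, hD⟩ := hψ.exists_lipschitzWith hg hr
  have hsupp : HasCompactSupport fun y => ψ (y, g y + r) := by
    refine HasCompactSupport.intro (isCompact_closedBall (0 : E) R) fun y hy => ?_
    refine hψ.eq_zero _ (by simpa using hr) ?_
    rw [Metric.mem_closedBall, dist_zero_right, not_le] at hy
    exact hy.trans_le (by rw [Prod.norm_def]; exact le_max_left _ _)
  -- Wherever `g` is differentiable, the integrand is the derivative along `a` of the restriction of
  -- `ψ` to the parallel graph.
  rw [← integral_lineDeriv_eq_zero hD hsupp a]
  refine integral_congr_ae ?_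
  filter_upwards [hg.ae_differentiableAt] with y hy
  have h1 : HasFDerivAt (fun y => (y, g y + r))
      ((ContinuousLinearMap.id ℝ E).prod (fderiv ℝ g y)) y :=
    (hasFDerivAt_id y).prodMk (hy.hasFDerivAt.add_const r)
  have h2 := (hψ.differentiableAt (y, g y + r) (by simpa using hr)).hasFDerivAt.comp y h1
  exact (h2.hasLineDerivAt a).lineDeriv.symm

/-- Along vertical lines, the normal derivative integrates to the boundary value. -/
theorem integral_vertical_eq (hψ : IsSubgraphTest g ψ M B R) (hg : Continuous g) (y : E) :
    ∫ r in Iio (0 : ℝ), fderiv ℝ ψ (y, g y + r) (0, 1) = ψ (y, g y) := by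
  -- Below this height the vertical line has left the ball outside of which `ψ` vanishes. This gives
  -- both the limit `0` at `-∞` and integrability of the derivative.
  have hfar : ∀ r : ℝ, r < -(|R| + |g y|) → r < 0 ∧ R < ‖((y, g y + r) : E × ℝ)‖ := by
    intro r hr
    have h0 : r < 0 := hr.trans_le (by simp only [Left.neg_nonpos_iff]; positivity)
    refine ⟨h0, ?_⟩
    rw [Prod.norm_def]
    refine lt_of_lt_of_le ?_ (le_max_right _ _)
    simp only [Real.norm_eq_abs]
    have := neg_abs_le (g y + r)
    have := le_abs_self R
    have := le_abs_self (g y)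
    linarith
  rw [← integral_Iic_eq_integral_Iio]
  have := integral_Iic_of_hasDerivAt_of_tendsto (a := (0 : ℝ)) (m := 0)
    (f := fun r => ψ (y, g y + r)) (f' := fun r => fderiv ℝ ψ (y, g y + r) (0, 1)) ?_ ?_ ?_ ?_
  · rw [this]; simp
  · have h := hψ.continuousWithinAt y
    have h2 : ContinuousWithinAt (fun r : ℝ => g y + r) (Iic 0) 0 := by fun_prop
    refine ContinuousWithinAt.comp (g := fun z => ψ (y, z)) (t := Iic (g y)) ?_ h2 ?_
    · simpa using h
    · intro r hr; simpa using hr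
  · intro r hr
    have h1 : HasDerivAt (fun r : ℝ => ((y, g y + r) : E × ℝ)) (0, 1) r :=
      (hasDerivAt_const r y).prodMk ((hasDerivAt_id r).const_add (g y))
    exact (hψ.differentiableAt (y, g y + r) (by simpa using hr)).hasFDerivAt.comp_hasDerivAt r h1
  · rw [integrableOn_Iic_iff_integrableOn_Iio]
    refine IntegrableOn.of_forall_sdiff_eq_zero (s := Ico (-(|R| + |g y|)) 0) ?_
      measurableSet_Iio ?_
    · refine Measure.integrableOn_of_bounded (M := M * ‖((0 : E), (1 : ℝ))‖) (by simp) ?_ ?_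
      · exact (((measurable_fderiv_apply_const ℝ ψ (0, 1)).comp
          (by fun_prop : Measurable fun r : ℝ => (y, g y + r)))).aestronglyMeasurable
      · refine (ae_restrict_iff' measurableSet_Ico).2 (Eventually.of_forall fun r hr => ?_)
        exact (fderiv ℝ ψ (y, g y + r)).le_of_opNorm_le
          (hψ.norm_fderiv_le _ (by simpa using hr.2)) _
    · intro r hr
      have hr' : r < -(|R| + |g y|) := by
        by_contra h
        exact hr.2 ⟨not_lt.1 h, hr.1⟩
      rw [hψ.fderiv_eq_zero hg (by simpa using (hfar r hr').1) (hfar r hr').2]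
      rfl
  · refine tendsto_const_nhds.congr' ?_
    filter_upwards [Iio_mem_atBot (-(|R| + |g y|))] with r hr
    exact (hψ.eq_zero _ (by simpa using (hfar r hr).1) (hfar r hr).2).symm

/-- The support is controlled at the sheared point, where `ψ` is evaluated; since the shear
preserves volume, `k` lives on a set of finite measure. -/
theorem integrableOn_of_bounded (hg : Continuous g) {k : E × ℝ → ℝ} (hk : Measurable k) {C : ℝ}
    (hC : ∀ p : E × ℝ, p.2 < 0 → |k p| ≤ C)
    (h0 : ∀ p : E × ℝ, p.2 < 0 → R < ‖shear hg p‖ → k p = 0) :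
    IntegrableOn k (univ ×ˢ Iio (0 : ℝ)) := by
  refine IntegrableOn.of_forall_sdiff_eq_zero
    (s := (univ ×ˢ Iio (0 : ℝ)) ∩ shear hg ⁻¹' Metric.closedBall 0 R) ?_
    (MeasurableSet.univ.prod measurableSet_Iio) ?_
  · refine Measure.integrableOn_of_bounded (M := C) ?_ hk.aestronglyMeasurable ?_
    · refine ne_top_of_le_ne_top ?_ (measure_mono inter_subset_right)
      rw [(measurePreserving_shear hg).measure_preimage
        Metric.isClosed_closedBall.measurableSet.nullMeasurableSet]
      exact measure_closedBall_lt_top.ne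
    · refine (ae_restrict_iff' ?_).2 (Eventually.of_forall fun p hp => hC p hp.1.2)
      exact (MeasurableSet.univ.prod measurableSet_Iio).inter
        ((shear hg).continuous.measurable Metric.isClosed_closedBall.measurableSet)
  · intro p hp
    refine h0 p hp.1.2 ?_
    by_contra h
    exact hp.2 ⟨hp.1, by simpa using h⟩

/-- **Divergence theorem** below the graph of a Lipschitz function, in a constant direction. -/
theorem integral_fderiv_eq (hψ : IsSubgraphTest g ψ M B R) (hg : LipschitzWith K g) (a : E)
    (b : ℝ) :
    ∫ p in {p : E × ℝ | p.2 < g p.1}, fderiv ℝ ψ p (a, b) =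
      ∫ y, ψ (y, g y) * (b - fderiv ℝ g y a) := by
  have hgc := hg.continuous
  -- Tangential part `T` and vertical part `N` of the derivative, from `(a, b) = (a, Dg a) + (b - Dg
  -- a) • (0, 1)`. The splitting is valid also where `g` is not differentiable and `fderiv` is `0`.
  set T : E × ℝ → ℝ := fun p => fderiv ℝ ψ (p.1, g p.1 + p.2) (a, fderiv ℝ g p.1 a)
  set N : E × ℝ → ℝ := fun p =>
    (b - fderiv ℝ g p.1 a) * fderiv ℝ ψ (p.1, g p.1 + p.2) (0, 1)
  have hM : 0 ≤ M := (norm_nonneg (fderiv ℝ ψ (0, g 0 - 1))).trans (hψ.norm_fderiv_le _ (by simp))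
  have hga : ∀ y, |fderiv ℝ g y a| ≤ K * ‖a‖ := fun y =>
    (fderiv ℝ g y).le_of_opNorm_le (norm_fderiv_le_of_lipschitz ℝ hg) a
  have hgm : Measurable fun p : E × ℝ => fderiv ℝ g p.1 a :=
    (measurable_fderiv_apply_const ℝ g a).comp measurable_fst
  have hΦm : Measurable fun p : E × ℝ => (p.1, g p.1 + p.2) := (shear hgc).continuous.measurable
  have hψm : Measurable fun p : E × ℝ => fderiv ℝ ψ (p.1, g p.1 + p.2) :=
    (measurable_fderiv ℝ ψ).comp hΦm
  have hT : IntegrableOn T (univ ×ˢ Iio (0 : ℝ)) := by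
    refine integrableOn_of_bounded (R := R) hgc (C := M * (‖a‖ + K * ‖a‖)) ?_ ?_ ?_
    · exact ContinuousLinearMap.measurable_apply₂.comp
        (hψm.prodMk (measurable_const.prodMk hgm))
    · intro p hp
      refine ((fderiv ℝ ψ (p.1, g p.1 + p.2)).le_of_opNorm_le
        (hψ.norm_fderiv_le _ (by simpa using hp)) _).trans ?_
      gcongr
      rw [Prod.norm_def]
      refine max_le (le_add_of_nonneg_right (by positivity)) ((hga _).trans ?_)
      exact le_add_of_nonneg_left (norm_nonneg _)
    · intro p hp hR
      have := hψ.fderiv_eq_zero hgc (p := (p.1, g p.1 + p.2)) (by simpa using hp) hR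
      simp [T, this]
  have hN : IntegrableOn N (univ ×ˢ Iio (0 : ℝ)) := by
    refine integrableOn_of_bounded (R := R) hgc
      (C := (|b| + K * ‖a‖) * (M * ‖((0 : E), (1 : ℝ))‖)) ?_ ?_ ?_
    · exact (measurable_const.sub hgm).mul
        ((measurable_fderiv_apply_const ℝ ψ (0, 1)).comp hΦm)
    · intro p hp
      rw [abs_mul]
      gcongr
      · exact (abs_sub _ _).trans (add_le_add le_rfl (hga _))
      · exact (fderiv ℝ ψ (p.1, g p.1 + p.2)).le_of_opNorm_le
          (hψ.norm_fderiv_le _ (by simpa using hp)) _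
    · intro p hp hR
      have := hψ.fderiv_eq_zero hgc (p := (p.1, g p.1 + p.2)) (by simpa using hp) hR
      simp [N, this]
  have hpre : shear hgc ⁻¹' {p : E × ℝ | p.2 < g p.1} = univ ×ˢ Iio (0 : ℝ) := by
    ext p; simp [shear]
  rw [← (measurePreserving_shear hgc).setIntegral_preimage_emb
    (shear hgc).measurableEmbedding, hpre]
  have hsplit : ∀ p : E × ℝ, fderiv ℝ ψ (shear hgc p) (a, b) = T p + N p := by
    intro p
    have : ((a, b) : E × ℝ) = (a, fderiv ℝ g p.1 a) + (b - fderiv ℝ g p.1 a) • (0, 1) := by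
      ext <;> simp
    rw [this, map_add, map_smul]
    rfl
  simp only [hsplit]
  -- Fubini in two orders: `N` is integrated along vertical lines first, `T` along parallel graphs
  -- first.
  rw [integral_add hT hN, Measure.volume_eq_prod, setIntegral_prod N hN,
    ← setIntegral_prod_swap, setIntegral_prod (fun z : ℝ × E => T z.swap) hT.swap]
  have hT0 : ∫ r in Iio (0 : ℝ), ∫ y in (univ : Set E), T ((r, y) : ℝ × E).swap = 0 := by
    refine setIntegral_eq_zero_of_forall_eq_zero fun r hr => ?_
    rw [setIntegral_univ]
    exact hψ.integral_tangential_eq_zero hg hr a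
  rw [hT0, zero_add, setIntegral_univ]
  refine integral_congr_ae (Eventually.of_forall fun y => ?_)
  simp only [N]
  rw [integral_const_mul, hψ.integral_vertical_eq hgc, mul_comm]

end IsSubgraphTest

end Subgraph

end Overset

namespace Overset

open Module (finrank)
open scoped ENNReal

/-! ### Boundary charts -/

section Chart

variable {n : ℕ}

/-- Cartesian coordinates as a linear equivalence from the product `ℝⁿ × ℝ`. -/
noncomputable def cartesian (L : WithLp 2 (EuclideanSpace ℝ (Fin n) × ℝ) ≃ₗᵢ[ℝ] Space n) :
    (EuclideanSpace ℝ (Fin n) × ℝ) ≃L[ℝ] Space n :=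
  (WithLp.prodContinuousLinearEquiv 2 ℝ (EuclideanSpace ℝ (Fin n)) ℝ).symm.trans
    L.toContinuousLinearEquiv

variable {L : WithLp 2 (EuclideanSpace ℝ (Fin n) × ℝ) ≃ₗᵢ[ℝ] Space n}

theorem cartesian_apply (p : EuclideanSpace ℝ (Fin n) × ℝ) :
    cartesian L p = L (WithLp.toLp 2 p) := rfl

theorem inner_cartesian (p q : EuclideanSpace ℝ (Fin n) × ℝ) :
    inner ℝ (cartesian L p) (cartesian L q) = inner ℝ p.1 q.1 + p.2 * q.2 := by
  rw [cartesian_apply, cartesian_apply, L.inner_map_map, WithLp.prod_inner_apply]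
  simp [mul_comm]

theorem norm_cartesian_sq (p : EuclideanSpace ℝ (Fin n) × ℝ) :
    ‖cartesian L p‖ ^ 2 = ‖p.1‖ ^ 2 + p.2 ^ 2 := by
  rw [← real_inner_self_eq_norm_sq, inner_cartesian, real_inner_self_eq_norm_sq, pow_two p.2]

theorem norm_fst_le_norm_cartesian (p : EuclideanSpace ℝ (Fin n) × ℝ) :
    ‖p.1‖ ≤ ‖cartesian L p‖ := by
  refine le_of_sq_le_sq ?_ (norm_nonneg _)
  rw [norm_cartesian_sq]
  nlinarith [sq_nonneg p.2]

theorem norm_cartesian_le (p : EuclideanSpace ℝ (Fin n) × ℝ) :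
    ‖cartesian L p‖ ≤ ‖p.1‖ + |p.2| := by
  refine le_of_sq_le_sq ?_ (by positivity)
  rw [norm_cartesian_sq, ← sq_abs p.2]
  nlinarith [mul_nonneg (norm_nonneg p.1) (abs_nonneg p.2)]

theorem measurePreserving_cartesian : MeasurePreserving (cartesian L) volume volume :=
  L.measurePreserving.comp (WithLp.volume_preserving_toLp (EuclideanSpace ℝ (Fin n)) ℝ)

theorem measurableEmbedding_cartesian : MeasurableEmbedding (cartesian L) :=
  (cartesian L).toHomeomorph.measurableEmbedding

/-- The graph of `g`, as a hypersurface in physical space. -/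
noncomputable def graphMap (L : WithLp 2 (EuclideanSpace ℝ (Fin n) × ℝ) ≃ₗᵢ[ℝ] Space n)
    (g : EuclideanSpace ℝ (Fin n) → ℝ) (y : EuclideanSpace ℝ (Fin n)) : Space n :=
  cartesian L (y, g y)

/-- The upward normal `(-∇g, 1)` of the graph of `g`, not normalized. -/
noncomputable def graphNormal (L : WithLp 2 (EuclideanSpace ℝ (Fin n) × ℝ) ≃ₗᵢ[ℝ] Space n)
    (g : EuclideanSpace ℝ (Fin n) → ℝ) (y : EuclideanSpace ℝ (Fin n)) : Space n :=
  cartesian L (-gradient g y, 1)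

variable {g : EuclideanSpace ℝ (Fin n) → ℝ} {K : ℝ≥0}

theorem norm_graphNormal (y : EuclideanSpace ℝ (Fin n)) :
    ‖graphNormal L g y‖ = √(1 + ‖gradient g y‖ ^ 2) := by
  rw [eq_comm, Real.sqrt_eq_iff_eq_sq (by positivity) (norm_nonneg _), graphNormal,
    norm_cartesian_sq]
  simp [add_comm]

theorem one_le_norm_graphNormal (y : EuclideanSpace ℝ (Fin n)) : 1 ≤ ‖graphNormal L g y‖ := by
  rw [norm_graphNormal, Real.one_le_sqrt]
  nlinarith [sq_nonneg ‖gradient g y‖]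

theorem inner_cartesian_graphNormal (p : EuclideanSpace ℝ (Fin n) × ℝ)
    (y : EuclideanSpace ℝ (Fin n)) :
    inner ℝ (cartesian L p) (graphNormal L g y) = p.2 - fderiv ℝ g y p.1 := by
  rw [graphNormal, inner_cartesian, inner_neg_right, real_inner_comm, inner_gradient_left]
  ring

theorem lipschitzWith_graphMap (hg : LipschitzWith K g) : LipschitzWith (1 + K) (graphMap L g) := by
  refine LipschitzWith.of_dist_le_mul fun x y => ?_
  rw [dist_eq_norm, graphMap, graphMap, ← map_sub]
  refine (norm_cartesian_le _).trans ?_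
  have := hg.dist_le_mul x y
  rw [Real.dist_eq] at this
  rw [dist_eq_norm] at this ⊢
  push_cast
  simp only [Prod.mk_sub_mk]
  linarith

theorem norm_sub_le_norm_graphMap_sub (x y : EuclideanSpace ℝ (Fin n)) :
    ‖x - y‖ ≤ ‖graphMap L g x - graphMap L g y‖ := by
  rw [graphMap, graphMap, ← map_sub]
  exact norm_fst_le_norm_cartesian ((x, g x) - (y, g y))

theorem measurableEmbedding_graphMap (hg : LipschitzWith K g) :
    MeasurableEmbedding (graphMap L g) := by
  have hanti : AntilipschitzWith 1 (graphMap L g) := AntilipschitzWith.of_le_mul_dist fun x y => by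
    simpa [dist_eq_norm] using norm_sub_le_norm_graphMap_sub x y
  exact (hanti.isClosedEmbedding
    (lipschitzWith_graphMap hg).uniformContinuous).measurableEmbedding

/-- The differential is `v ↦ (v, Dg v)` in Cartesian coordinates, so `normDet_graph` applies with `w
= ∇g`. -/
theorem normDet_fderiv_graphMap {y : EuclideanSpace ℝ (Fin n)} (hy : DifferentiableAt ℝ g y) :
    (fderiv ℝ (graphMap L g) y).toLinearMap.normDet = ‖graphNormal L g y‖ := by
  have h1 : HasFDerivAt (fun y => (y, g y))
      ((ContinuousLinearMap.id ℝ (EuclideanSpace ℝ (Fin n))).prod (fderiv ℝ g y)) y :=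
    (hasFDerivAt_id y).prodMk hy.hasFDerivAt
  have h2 : HasFDerivAt (graphMap L g) _ y := (cartesian L).hasFDerivAt.comp y h1
  rw [h2.fderiv, norm_graphNormal]
  refine normDet_graph fun v w => ?_
  rw [inner_gradient_left, inner_gradient_left]
  exact inner_cartesian _ _

/-- Surface measure on a Lipschitz graph. -/
theorem euclideanHausdorffMeasure_restrict_graph (hg : LipschitzWith K g) :
    (Measure.euclideanHausdorffMeasure n).restrict (range (graphMap L g)) =
      Measure.map (graphMap L g)
        (volume.withDensity fun y => ENNReal.ofReal ‖graphNormal L g y‖) := by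
  have h := euclideanHausdorffMeasure_restrict_range (lipschitzWith_graphMap (L := L) hg)
    norm_sub_le_norm_graphMap_sub
  rw [finrank_euclideanSpace_fin] at h
  rw [h]
  congr 1
  refine withDensity_congr_ae ?_
  filter_upwards [hg.ae_differentiableAt] with y hy
  rw [normDet_fderiv_graphMap hy]

theorem measurable_graphNormal : Measurable (graphNormal L g) := by
  have h : Measurable (gradient g) :=
    (InnerProductSpace.toDual ℝ (EuclideanSpace ℝ (Fin n))).symm.continuous.measurable.comp
      (measurable_fderiv ℝ g)
  exact (cartesian L).continuous.measurable.comp (h.neg.prodMk measurable_const)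

/-! ### The exterior normal -/

/-- If the normals differ, the direction `e = ν' - ν` points inward for `ν` and outward for `ν'`, so
`x + t • e` is both in and out of `Ω` for small `t > 0`. The tolerance `ε` makes `ε * ‖e‖` half of
`1 - ⟨ν, ν'⟩`. -/
theorem IsOutwardUnitNormal.eq {Ω : Set (Space n)} {x ν ν' : Space n}
    (h : IsOutwardUnitNormal Ω x ν) (h' : IsOutwardUnitNormal Ω x ν') : ν = ν' := by
  by_contra hne
  set c : ℝ := inner ℝ ν ν'
  have hc : c < 1 := inner_lt_one_iff_real_of_norm_eq_one h.1 h'.1 |>.2 hne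
  set e : Space n := ν' - ν
  have he1 : inner ℝ e ν = c - 1 := by
    rw [inner_sub_left, real_inner_self_eq_norm_sq, h.1, real_inner_comm]; norm_num [c]
  have he2 : inner ℝ e ν' = 1 - c := by
    rw [inner_sub_left, real_inner_self_eq_norm_sq, h'.1]; norm_num [c]
  have he0 : 0 < ‖e‖ := norm_pos_iff.2 (sub_ne_zero.2 (Ne.symm hne))
  set ε : ℝ := (1 - c) / (2 * ‖e‖) with hε
  have hε0 : 0 < ε := div_pos (by linarith) (by positivity)
  have hεe : ε * ‖e‖ = (1 - c) / 2 := by rw [hε]; field_simp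
  have hlim : Tendsto (fun t : ℝ => x + t • e) (𝓝[>] 0) (𝓝 x) := by
    have : ContinuousAt (fun t : ℝ => x + t • e) 0 := by fun_prop
    simpa using this.tendsto.mono_left nhdsWithin_le_nhds
  obtain ⟨t, h1, h2, ht⟩ := ((hlim.eventually (h.2 ε hε0)).and
    ((hlim.eventually (h'.2 ε hε0)).and self_mem_nhdsWithin)).exists
  have ht : 0 < t := ht
  refine h2.2 ?_ (h1.1 ?_)
  · rw [add_sub_cancel_left, norm_smul, inner_smul_left, Real.norm_of_nonneg ht.le, he2,
      mul_left_comm, hεe]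
    simp only [conj_trivial]
    nlinarith
  · rw [add_sub_cancel_left, norm_smul, inner_smul_left, Real.norm_of_nonneg ht.le, he1,
      mul_left_comm, hεe]
    simp only [conj_trivial]
    nlinarith

theorem IsOutwardUnitNormal.outwardNormal_eq {Ω : Set (Space n)} {x ν : Space n}
    (h : IsOutwardUnitNormal Ω x ν) : outwardNormal Ω x = ν := by
  have hex : ∃ ν, IsOutwardUnitNormal Ω x ν := ⟨ν, h⟩
  rw [outwardNormal, dif_pos hex]
  exact hex.choose_spec.eq h

/-- The default value `0` keeps the bound valid where no normal exists. -/
theorem norm_outwardNormal_le (Ω : Set (Space n)) (x : Space n) : ‖outwardNormal Ω x‖ ≤ 1 := by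
  by_cases hex : ∃ ν, IsOutwardUnitNormal Ω x ν
  · rw [outwardNormal, dif_pos hex]
    exact hex.choose_spec.1.le
  · rw [outwardNormal, dif_neg hex]
    simp

/-- The exterior normal is a local notion. -/
theorem outwardNormal_congr {Ω Ω' : Set (Space n)} {x : Space n}
    (h : ∀ᶠ y in 𝓝 x, (y ∈ Ω ↔ y ∈ Ω')) : outwardNormal Ω x = outwardNormal Ω' x := by
  have : IsOutwardUnitNormal Ω x = IsOutwardUnitNormal Ω' x := by
    ext ν
    refine and_congr_right fun _ => forall₂_congr fun ε _ => eventually_congr ?_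
    filter_upwards [h] with y hy
    rw [hy]
  unfold outwardNormal
  rw [this]

/-- In the neighbourhood `W`, the open set `Ω` is the region below the graph of `g`. -/
structure IsBoundaryChart (Ω : Set (Space n))
    (L : WithLp 2 (EuclideanSpace ℝ (Fin n) × ℝ) ≃ₗᵢ[ℝ] Space n)
    (g : EuclideanSpace ℝ (Fin n) → ℝ) (K : ℝ≥0) (W : Set (Space n)) : Prop where
  isOpen_domain : IsOpen Ω
  isOpen : IsOpen W
  lipschitzWith : LipschitzWith K g
  mem_iff : ∀ p, cartesian L p ∈ W → (cartesian L p ∈ Ω ↔ p.2 < g p.1)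

namespace IsBoundaryChart

variable {Ω W : Set (Space n)}

/-- A point above the graph has a neighbourhood that misses `Ω`; a point on the graph is approached
vertically from below, inside `Ω`. -/
theorem mem_frontier_iff (h : IsBoundaryChart Ω L g K W) {p : EuclideanSpace ℝ (Fin n) × ℝ}
    (hp : cartesian L p ∈ W) : cartesian L p ∈ frontier Ω ↔ p.2 = g p.1 := by
  rw [h.isOpen_domain.frontier_eq, Set.mem_sdiff, h.mem_iff p hp, not_lt]
  have hgc := h.lipschitzWith.continuous
  constructor
  · rintro ⟨hcl, hge⟩
    refine le_antisymm (not_lt.1 fun hlt => ?_) hge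
    have hV : W ∩ (cartesian L).symm ⁻¹' {q | g q.1 < q.2} ∈ 𝓝 (cartesian L p) := by
      refine inter_mem (h.isOpen.mem_nhds hp) (IsOpen.mem_nhds ?_ (by simpa using hlt))
      exact (isOpen_lt (hgc.comp continuous_fst) continuous_snd).preimage
        (cartesian L).symm.continuous
    obtain ⟨q, ⟨hqW, hq⟩, hqΩ⟩ := mem_closure_iff_nhds.1 hcl _ hV
    obtain ⟨q, rfl⟩ := (cartesian L).surjective q
    rw [mem_preimage, ContinuousLinearEquiv.symm_apply_apply] at hq
    exact lt_asymm ((h.mem_iff q hqW).1 hqΩ) hq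
  · intro heq
    refine ⟨?_, heq.ge⟩
    have hlim : Tendsto (fun t : ℝ => cartesian L (p.1, p.2 - t)) (𝓝[>] 0)
        (𝓝 (cartesian L p)) := by
      have : ContinuousAt (fun t : ℝ => cartesian L (p.1, p.2 - t)) 0 :=
        ((cartesian L).continuous.comp (by fun_prop)).continuousAt
      simpa using this.tendsto.mono_left nhdsWithin_le_nhds
    refine mem_closure_of_tendsto hlim ?_
    filter_upwards [hlim.eventually (h.isOpen.mem_nhds hp), self_mem_nhdsWithin] with t ht ht'
    rw [h.mem_iff _ ht, ← heq]
    simpa using ht'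

theorem frontier_inter (h : IsBoundaryChart Ω L g K W) :
    frontier Ω ∩ W = range (graphMap L g) ∩ W := by
  ext x
  obtain ⟨p, rfl⟩ := (cartesian L).surjective x
  refine and_congr_left fun hp => ?_
  rw [h.mem_frontier_iff hp]
  constructor
  · intro hp; exact ⟨p.1, by rw [graphMap, ← hp]⟩
  · rintro ⟨y, hy⟩
    have := (cartesian L).injective hy
    rw [← this]

/-- Differentiability keeps the graph within `ε * ‖p.1 - y‖` of its tangent plane, which is the
error that the definition permits. Normalizing is harmless because `graphNormal` has norm at least
`1`. -/
theorem isOutwardUnitNormal (h : IsBoundaryChart Ω L g K W) {y : EuclideanSpace ℝ (Fin n)}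
    (hy : DifferentiableAt ℝ g y) (hyW : graphMap L g y ∈ W) :
    IsOutwardUnitNormal Ω (graphMap L g y)
      (‖graphNormal L g y‖⁻¹ • graphNormal L g y) := by
  have hN := one_le_norm_graphNormal (L := L) (g := g) y
  have hN0 : 0 < ‖graphNormal L g y‖ := by linarith
  refine ⟨by rw [norm_smul, norm_inv, norm_norm, inv_mul_cancel₀ hN0.ne'], fun ε hε => ?_⟩
  have hfst : Tendsto (fun x => ((cartesian L).symm x).1) (𝓝 (graphMap L g y)) (𝓝 y) := by
    have : ContinuousAt (fun x => ((cartesian L).symm x).1) (graphMap L g y) :=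
      (continuous_fst.comp (cartesian L).symm.continuous).continuousAt
    simpa [ContinuousAt, graphMap] using this
  have hlin := hfst.eventually ((hasFDerivAt_iff_isLittleO.1 hy.hasFDerivAt).def hε)
  filter_upwards [h.isOpen.mem_nhds hyW, hlin] with x hxW hx
  obtain ⟨p, rfl⟩ := (cartesian L).surjective x
  rw [ContinuousLinearEquiv.symm_apply_apply, Real.norm_eq_abs] at hx
  rw [h.mem_iff p hxW]
  have hin : inner ℝ (cartesian L p - graphMap L g y) (‖graphNormal L g y‖⁻¹ • graphNormal L g y)
      = ‖graphNormal L g y‖⁻¹ * (p.2 - g y - fderiv ℝ g y (p.1 - y)) := by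
    rw [inner_smul_right, graphMap, ← map_sub, inner_cartesian_graphNormal]
    rfl
  have hle : ‖p.1 - y‖ ≤ ‖cartesian L p - graphMap L g y‖ := by
    rw [graphMap, ← map_sub]; exact norm_fst_le_norm_cartesian (p - (y, g y))
  have hle' : ε * ‖p.1 - y‖ ≤ ‖graphNormal L g y‖ * (ε * ‖cartesian L p - graphMap L g y‖) := by
    calc ε * ‖p.1 - y‖ ≤ 1 * (ε * ‖cartesian L p - graphMap L g y‖) := by
          rw [one_mul]; gcongr
      _ ≤ _ := by gcongr
  rw [hin, inv_mul_lt_iff₀ hN0, lt_inv_mul_iff₀ hN0, not_lt, mul_neg]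
  have hx' := abs_le.1 hx
  constructor
  · intro hlt; linarith
  · intro hlt; linarith

theorem ae_outwardNormal_eq (h : IsBoundaryChart Ω L g K W) :
    ∀ᵐ y, graphMap L g y ∈ W →
      outwardNormal Ω (graphMap L g y) = ‖graphNormal L g y‖⁻¹ • graphNormal L g y := by
  filter_upwards [h.lipschitzWith.ae_differentiableAt] with y hy hyW
  exact (h.isOutwardUnitNormal hy hyW).outwardNormal_eq

theorem surface_restrict (h : IsBoundaryChart Ω L g K W) :
    (surface (frontier Ω)).restrict W =
      (Measure.map (graphMap L g)
        (volume.withDensity fun y => ENNReal.ofReal ‖graphNormal L g y‖)).restrict W := by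
  rw [surface, Measure.restrict_restrict h.isOpen.measurableSet, inter_comm, h.frontier_inter,
    ← euclideanHausdorffMeasure_restrict_graph h.lipschitzWith,
    Measure.restrict_restrict h.isOpen.measurableSet, inter_comm]

theorem measurable_density : Measurable fun y => ENNReal.ofReal ‖graphNormal L g y‖ :=
  (measurable_graphNormal (L := L) (g := g)).norm.ennreal_ofReal

/-- Pulled back to the parameter domain, the normal agrees almost everywhere with an explicit
measurable function of `∇g`. -/
theorem aestronglyMeasurable_outwardNormal (h : IsBoundaryChart Ω L g K W) :
    AEStronglyMeasurable (outwardNormal Ω) ((surface (frontier Ω)).restrict W) := by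
  have hemb := measurableEmbedding_graphMap (L := L) h.lipschitzWith
  rw [h.surface_restrict, hemb.restrict_map, hemb.aestronglyMeasurable_map_iff]
  have hm : AEStronglyMeasurable (fun y => ‖graphNormal L g y‖⁻¹ • graphNormal L g y)
      ((volume.withDensity fun y => ENNReal.ofReal ‖graphNormal L g y‖).restrict
        (graphMap L g ⁻¹' W)) :=
    (measurable_graphNormal.norm.inv.smul measurable_graphNormal).aestronglyMeasurable
  refine hm.congr ?_
  refine (ae_restrict_iff' (hemb.measurable h.isOpen.measurableSet)).2 ?_
  refine (withDensity_absolutelyContinuous _ _).ae_le ?_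
  filter_upwards [h.ae_outwardNormal_eq] with y hy hyW
  exact (hy hyW).symm

/-- Surface measure is finite on the boundary near each point. -/
theorem surface_lt_top (h : IsBoundaryChart Ω L g K W) (hW : Bornology.IsBounded W) :
    surface (frontier Ω) W < ∞ := by
  rw [surface, Measure.restrict_apply h.isOpen.measurableSet, inter_comm, h.frontier_inter]
  set s := (fun x => ((cartesian L).symm x).1) '' W
  have hs : Bornology.IsBounded s := by
    have h1 := (cartesian L).symm.lipschitz.isBounded_image hW
    have h2 := (LipschitzWith.prod_fst (α := EuclideanSpace ℝ (Fin n)) (β := ℝ)).isBounded_image h1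
    rwa [image_image] at h2
  have hsub : range (graphMap L g) ∩ W ⊆ graphMap L g '' s := by
    rintro _ ⟨⟨y, rfl⟩, hy⟩
    exact ⟨y, ⟨_, hy, by simp [graphMap]⟩, rfl⟩
  refine (measure_mono hsub).trans_lt ?_
  refine (euclideanHausdorffMeasure_image_le_of_lipschitzOnWith
    ((lipschitzWith_graphMap h.lipschitzWith).lipschitzOnWith) n).trans_lt ?_
  rw [EuclideanSpace.euclideanHausdorffMeasure_eq_volume]
  exact ENNReal.mul_lt_top (by simp) hs.measure_lt_top

/-- Surface integrals in a chart. -/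
theorem integral_surface (h : IsBoundaryChart Ω L g K W) {ψ : Space n → ℝ}
    (hψ : ∀ x, x ∉ W → ψ x = 0) (p : EuclideanSpace ℝ (Fin n) × ℝ) :
    ∫ x, ψ x * inner ℝ (cartesian L p) (outwardNormal Ω x) ∂(surface (frontier Ω)) =
      ∫ y, ψ (graphMap L g y) * (p.2 - fderiv ℝ g y p.1) := by
  have hemb := measurableEmbedding_graphMap (L := L) h.lipschitzWith
  have hpre := hemb.measurable h.isOpen.measurableSet
  have hR : ∫ y, ψ (graphMap L g y) * (p.2 - fderiv ℝ g y p.1) =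
      ∫ y in graphMap L g ⁻¹' W, ψ (graphMap L g y) * (p.2 - fderiv ℝ g y p.1) :=
    (setIntegral_eq_integral_of_forall_compl_eq_zero
      (fun y hy => by rw [hψ _ hy, zero_mul])).symm
  rw [hR, ← setIntegral_eq_integral_of_forall_compl_eq_zero (s := W)
      (fun x hx => by rw [hψ x hx, zero_mul]), h.surface_restrict, hemb.setIntegral_map,
    setIntegral_withDensity_eq_setIntegral_toReal_smul measurable_density
      (Eventually.of_forall fun _ => ENNReal.ofReal_lt_top) _ hpre]
  refine setIntegral_congr_ae hpre ?_
  filter_upwards [h.ae_outwardNormal_eq] with y hy hyW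
  have hN : ‖graphNormal L g y‖ ≠ 0 := by linarith [one_le_norm_graphNormal (L := L) (g := g) y]
  -- The area density `‖graphNormal L g y‖` cancels the normalization of the unit normal.
  rw [hy hyW, inner_smul_right, inner_cartesian_graphNormal,
    ENNReal.toReal_ofReal (norm_nonneg _), smul_eq_mul]
  field_simp

end IsBoundaryChart

end Chart

end Overset

namespace Overset

open scoped ENNReal

/-! ### The divergence theorem on bounded Lipschitz domains -/

section Divergence

variable {n : ℕ} {Ω : Set (Space n)} {F χ : Space n → ℝ} {M : ℝ}

/-- `F` is continuous up to the boundary of `Ω` and differentiable in `Ω` with bounded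
derivative. -/
structure HasBoundedGradient (Ω : Set (Space n)) (F : Space n → ℝ) (M : ℝ) : Prop where
  continuousOn : ContinuousOn F (closure Ω)
  differentiableAt : ∀ x ∈ Ω, DifferentiableAt ℝ F x
  norm_fderiv_le : ∀ x ∈ Ω, ‖fderiv ℝ F x‖ ≤ M

namespace HasBoundedGradient

theorem exists_abs_le (hF : HasBoundedGradient Ω F M) (hb : Bornology.IsBounded Ω) :
    ∃ B, ∀ x ∈ closure Ω, |F x| ≤ B :=
  hb.isCompact_closure.exists_bound_of_continuousOn hF.continuousOn

theorem integrableOn_fderiv (hF : HasBoundedGradient Ω F M) (ho : IsOpen Ω)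
    (hb : Bornology.IsBounded Ω) (e : Space n) :
    IntegrableOn (fun x => fderiv ℝ F x e) Ω := by
  refine Measure.integrableOn_of_bounded (M := M * ‖e‖) hb.measure_lt_top.ne
    (measurable_fderiv_apply_const ℝ F e).aestronglyMeasurable ?_
  refine (ae_restrict_iff' ho.measurableSet).2 (Eventually.of_forall fun x hx => ?_)
  exact (fderiv ℝ F x).le_of_opNorm_le (hF.norm_fderiv_le x hx) e

/-- Cutting off with a smooth compactly supported function preserves bounds, at all points that are
in `Ω` or outside of the support of the cutoff. -/
theorem exists_cutoff_bounds (hF : HasBoundedGradient Ω F M) (hb : Bornology.IsBounded Ω)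
    (hχ : ContDiff ℝ 1 χ) (hχc : HasCompactSupport χ) :
    ∃ M' B', ∀ x, (x ∈ tsupport χ → x ∈ Ω) → DifferentiableAt ℝ (fun y => χ y * F y) x ∧
      ‖fderiv ℝ (fun y => χ y * F y) x‖ ≤ M' ∧ |χ x * F x| ≤ B' := by
  obtain ⟨B, hB⟩ := hF.exists_abs_le hb
  obtain ⟨b, hb'⟩ := hχc.exists_bound_of_continuous hχ.continuous
  obtain ⟨m, hm⟩ := (hχc.fderiv ℝ).exists_bound_of_continuous (hχ.continuous_fderiv one_ne_zero)
  -- Constants from the product rule; the absolute values make them nonnegative, as needed off the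
  -- support of `χ`, where the product vanishes.
  refine ⟨|b| * |M| + |B| * |m|, |b| * |B|, fun x hx => ?_⟩
  by_cases hxs : x ∈ tsupport χ
  · have hxΩ := hx hxs
    have hχx : DifferentiableAt ℝ χ x := hχ.differentiable one_ne_zero x
    have hFx := hF.differentiableAt x hxΩ
    have hBx := (hB x (subset_closure hxΩ)).trans (le_abs_self B)
    have hbx := (hb' x).trans (le_abs_self b)
    refine ⟨hχx.mul hFx, ?_, ?_⟩
    · rw [fderiv_fun_mul hχx hFx]
      refine (norm_add_le _ _).trans (add_le_add ?_ ?_)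
      · rw [norm_smul]
        gcongr
        exact (hF.norm_fderiv_le x hxΩ).trans (le_abs_self M)
      · rw [norm_smul]
        gcongr
        · exact hBx
        · exact (hm x).trans (le_abs_self m)
    · rw [abs_mul]
      exact mul_le_mul hbx hBx (abs_nonneg _) (abs_nonneg _)
  · have h0 : (fun y => χ y * F y) =ᶠ[𝓝 x] fun _ => 0 := by
      filter_upwards [notMem_tsupport_iff_eventuallyEq.1 hxs] with y hy
      rw [hy, Pi.zero_apply, zero_mul]
    refine ⟨h0.differentiableAt_iff.2 (differentiableAt_const _), ?_, ?_⟩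
    · rw [h0.fderiv_eq]
      simp only [fderiv_fun_const, Pi.zero_apply, norm_zero]
      positivity
    · rw [h0.eq_of_nhds, abs_zero]
      positivity

/-- The divergence theorem for functions supported inside of the domain. -/
theorem integral_fderiv_cutoff_eq_zero (hF : HasBoundedGradient Ω F M)
    (hb : Bornology.IsBounded Ω) (hχ : ContDiff ℝ 1 χ) (hχc : HasCompactSupport χ)
    (hsub : tsupport χ ⊆ Ω) (e : Space n) :
    ∫ x in Ω, fderiv ℝ (fun y => χ y * F y) x e = 0 := by
  obtain ⟨M', B', h⟩ := hF.exists_cutoff_bounds hb hχ hχc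
  have hd : Differentiable ℝ fun y => χ y * F y := fun x => (h x fun hx => hsub hx).1
  have hlip : LipschitzWith M'.toNNReal fun y => χ y * F y :=
    lipschitzWith_of_nnnorm_fderiv_le hd fun x => by
      rw [← NNReal.coe_le_coe, coe_nnnorm]
      exact (h x fun hx => hsub hx).2.1.trans (Real.le_coe_toNNReal _)
  rw [setIntegral_eq_integral_of_forall_compl_eq_zero,
    ← integral_lineDeriv_eq_zero hlip hχc.mul_right e]
  · exact integral_congr_ae (Eventually.of_forall fun x => (hd x).lineDeriv_eq_fderiv.symm)
  · intro x hx
    have h0 : (fun y => χ y * F y) =ᶠ[𝓝 x] fun _ => 0 := by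
      filter_upwards [notMem_tsupport_iff_eventuallyEq.1 fun h => hx (hsub h)] with y hy
      rw [hy, Pi.zero_apply, zero_mul]
    rw [h0.fderiv_eq]
    simp

end HasBoundedGradient

/-! ### Localization to one boundary chart -/

section LocalChart

variable {L : WithLp 2 (EuclideanSpace ℝ (Fin n) × ℝ) ≃ₗᵢ[ℝ] Space n}
  {g : EuclideanSpace ℝ (Fin n) → ℝ} {K : ℝ≥0} {W : Set (Space n)}

/-- Because the cutoff is supported in `W`, the transported function is controlled below the entire
graph of `g`, even where that graph leaves `W` and need not bound `Ω`. -/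
theorem IsBoundaryChart.exists_isSubgraphTest (h : IsBoundaryChart Ω L g K W)
    (hF : HasBoundedGradient Ω F M) (hb : Bornology.IsBounded Ω) (hχ : ContDiff ℝ 1 χ)
    (hχc : HasCompactSupport χ) (hsub : tsupport χ ⊆ W) :
    ∃ M' B' R, IsSubgraphTest g ((fun y => χ y * F y) ∘ cartesian L) M' B' R := by
  obtain ⟨M', B', hM'⟩ := hF.exists_cutoff_bounds hb hχ hχc
  have hin : ∀ p : EuclideanSpace ℝ (Fin n) × ℝ, p.2 < g p.1 →
      cartesian L p ∈ tsupport χ → cartesian L p ∈ Ω :=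
    fun p hp hpχ => (h.mem_iff p (hsub hpχ)).2 hp
  obtain ⟨R, hR⟩ := ((hχc.isCompact.image (cartesian L).symm.continuous).isBounded).exists_norm_le
  refine ⟨M' * ‖(cartesian L).toContinuousLinearMap‖, B', R, ?_, ?_, ?_, ?_, ?_⟩
  · intro p hp
    exact (cartesian L).comp_right_differentiableAt_iff.2 (hM' _ (hin p hp)).1
  · intro p hp
    rw [(cartesian L).comp_right_fderiv]
    refine (ContinuousLinearMap.opNorm_comp_le _ _).trans ?_
    gcongr
    exact (hM' _ (hin p hp)).2.1
  · exact fun p hp => (hM' _ (hin p hp)).2.2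
  · intro p _ hpR
    have : cartesian L p ∉ tsupport χ := fun hp => by
      have := hR _ ⟨_, hp, rfl⟩
      rw [ContinuousLinearEquiv.symm_apply_apply] at this
      linarith
    simp [image_eq_zero_of_notMem_tsupport this]
  · intro y
    have hline : Continuous fun z : ℝ => cartesian L (y, z) :=
      (cartesian L).continuous.comp (by fun_prop)
    by_cases hyW : cartesian L (y, g y) ∈ W
    · refine (hχ.continuous.comp hline).continuousWithinAt.mul ?_
      have hyΩ : cartesian L (y, g y) ∈ closure Ω :=
        frontier_subset_closure ((h.mem_frontier_iff hyW).2 rfl)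
      have hlim : Tendsto (fun z : ℝ => cartesian L (y, z)) (𝓝[≤] (g y))
          (𝓝[closure Ω] (cartesian L (y, g y))) := by
        refine tendsto_nhdsWithin_iff.2 ⟨hline.continuousWithinAt, ?_⟩
        filter_upwards [hline.continuousWithinAt.eventually (h.isOpen.mem_nhds hyW),
          self_mem_nhdsWithin] with z hz hz'
        rcases (show z ≤ g y from hz').lt_or_eq with hlt | heq
        · exact subset_closure ((h.mem_iff _ hz).2 hlt)
        · exact heq ▸ hyΩ
      exact (hF.continuousOn _ hyΩ).tendsto.comp hlim
    · have h0 : (fun z : ℝ => χ (cartesian L (y, z)) * F (cartesian L (y, z))) =ᶠ[𝓝 (g y)]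
          fun _ => 0 := by
        have := notMem_tsupport_iff_eventuallyEq.1 fun hp => hyW (hsub hp)
        filter_upwards [hline.continuousAt.eventually this] with z hz
        rw [hz, Pi.zero_apply, zero_mul]
      exact (continuousAt_const.congr h0.symm).continuousWithinAt

/-- The divergence theorem for functions supported in a boundary chart. -/
theorem IsBoundaryChart.integral_fderiv_cutoff_eq (h : IsBoundaryChart Ω L g K W)
    (hF : HasBoundedGradient Ω F M) (hb : Bornology.IsBounded Ω) (hχ : ContDiff ℝ 1 χ)
    (hχc : HasCompactSupport χ) (hsub : tsupport χ ⊆ W) (e : Space n) :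
    ∫ x in Ω, fderiv ℝ (fun y => χ y * F y) x e =
      ∫ x, χ x * F x * inner ℝ e (outwardNormal Ω x) ∂(surface (frontier Ω)) := by
  obtain ⟨M', B', R, hψ⟩ := h.exists_isSubgraphTest hF hb hχ hχc hsub
  obtain ⟨p, rfl⟩ := (cartesian L).surjective e
  have hout : ∀ x ∉ W, fderiv ℝ (fun y => χ y * F y) x = 0 := fun x hx => by
    have h0 : (fun y => χ y * F y) =ᶠ[𝓝 x] fun _ => 0 := by
      filter_upwards [notMem_tsupport_iff_eventuallyEq.1 fun h => hx (hsub h)] with y hy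
      rw [hy, Pi.zero_apply, zero_mul]
    rw [h0.fderiv_eq]
    simp
  rw [h.integral_surface (ψ := fun x => χ x * F x) (fun x hx => by
    rw [image_eq_zero_of_notMem_tsupport fun h => hx (hsub h), zero_mul])]
  have key := hψ.integral_fderiv_eq h.lipschitzWith p.1 p.2
  refine Eq.trans ?_ key
  rw [← measurePreserving_cartesian.setIntegral_preimage_emb measurableEmbedding_cartesian,
    ← integral_indicator (measurableEmbedding_cartesian.measurable h.isOpen_domain.measurableSet),
    ← integral_indicator (isOpen_subgraph h.lipschitzWith.continuous).measurableSet]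
  congr 1
  ext q
  have hq : fderiv ℝ ((fun y => χ y * F y) ∘ cartesian L) q (p.1, p.2) =
      fderiv ℝ (fun y => χ y * F y) (cartesian L q) (cartesian L p) := by
    rw [(cartesian L).comp_right_fderiv]; rfl
  -- The preimage of `Ω` and the subgraph need agree only over `W`; elsewhere the derivative
  -- vanishes.
  by_cases hqW : cartesian L q ∈ W
  · have hiff := h.mem_iff q hqW
    by_cases hqΩ : cartesian L q ∈ Ω
    · rw [indicator_of_mem (show q ∈ cartesian L ⁻¹' Ω from hqΩ), indicator_of_mem, hq]
      exact hiff.1 hqΩ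
    · rw [indicator_of_notMem (show q ∉ cartesian L ⁻¹' Ω from hqΩ), indicator_of_notMem]
      exact fun h' => hqΩ (hiff.2 h')
  · classical
    rw [indicator_apply, indicator_apply, hq, hout _ hqW]
    simp

end LocalChart

/-- Every boundary point of a Lipschitz domain has a bounded boundary chart. -/
theorem HasLipschitzBoundary.exists_isBoundaryChart (hL : HasLipschitzBoundary Ω)
    (ho : IsOpen Ω) {x : Space n} (hx : x ∈ frontier Ω) :
    ∃ L g K W, IsBoundaryChart Ω L g K W ∧ x ∈ W ∧ Bornology.IsBounded W := by
  obtain ⟨L, g, K, hg, hev⟩ := hL x hx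
  obtain ⟨V, hV, hVo, hxV⟩ := eventually_nhds_iff.1 hev
  refine ⟨L, g, K, V ∩ Metric.ball x 1, ⟨ho, hVo.inter Metric.isOpen_ball, hg, ?_⟩,
    ⟨hxV, Metric.mem_ball_self one_pos⟩, Metric.isBounded_ball.subset inter_subset_right⟩
  intro p hp
  have := hV _ hp.1
  rwa [cartesian_apply, L.symm_apply_apply] at this

/-- The boundary of a bounded Lipschitz domain has finite area. -/
theorem HasLipschitzBoundary.isFiniteMeasure_surface (hL : HasLipschitzBoundary Ω)
    (ho : IsOpen Ω) (hb : Bornology.IsBounded Ω) : IsFiniteMeasure (surface (frontier Ω)) := by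
  have hK : IsCompact (frontier Ω) :=
    hb.isCompact_closure.of_isClosed_subset isClosed_frontier frontier_subset_closure
  refine ⟨?_⟩
  have : surface (frontier Ω) univ = surface (frontier Ω) (frontier Ω) := by
    simp [surface]
  rw [this]
  refine hK.measure_lt_top_of_nhdsWithin fun x hx => ?_
  obtain ⟨L, g, K, W, hc, hxW, hWb⟩ := hL.exists_isBoundaryChart ho hx
  exact ⟨W, mem_nhdsWithin_of_mem_nhds (hc.isOpen.mem_nhds hxW), hc.surface_lt_top hWb⟩

/-- The exterior normal of a bounded Lipschitz domain is measurable on the boundary. -/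
theorem HasLipschitzBoundary.aestronglyMeasurable_outwardNormal (hL : HasLipschitzBoundary Ω)
    (ho : IsOpen Ω) (hb : Bornology.IsBounded Ω) :
    AEStronglyMeasurable (outwardNormal Ω) (surface (frontier Ω)) := by
  have hK : IsCompact (frontier Ω) :=
    hb.isCompact_closure.of_isClosed_subset isClosed_frontier frontier_subset_closure
  have hloc : ∀ x : frontier Ω, ∃ W, IsOpen W ∧ (x : Space n) ∈ W ∧
      AEStronglyMeasurable (outwardNormal Ω) ((surface (frontier Ω)).restrict W) := fun x => by
    obtain ⟨L, g, K, W, hc, hxW, -⟩ := hL.exists_isBoundaryChart ho x.2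
    exact ⟨W, hc.isOpen, hxW, hc.aestronglyMeasurable_outwardNormal⟩
  choose W hWo hxW hW using hloc
  obtain ⟨t, ht⟩ := hK.elim_finite_subcover W hWo fun x hx => mem_iUnion.2 ⟨⟨x, hx⟩, hxW _⟩
  have h1 : AEStronglyMeasurable (outwardNormal Ω)
      ((surface (frontier Ω)).restrict (⋃ x : t, W x)) :=
    aestronglyMeasurable_iUnion_iff.2 fun x => hW x
  have h2 : surface (frontier Ω) = (surface (frontier Ω)).restrict (⋃ x : t, W x) := by
    refine (Measure.restrict_eq_self_of_ae_mem ?_).symm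
    refine (ae_restrict_iff' isClosed_frontier.measurableSet).2 (Eventually.of_forall fun x hx => ?_)
    obtain ⟨i, hi, hxi⟩ := mem_iUnion₂.1 (ht hx)
    exact mem_iUnion.2 ⟨⟨i, hi⟩, hxi⟩
  rwa [← h2] at h1

/-- A set of finite `n`-dimensional Hausdorff measure is null in dimension `n + 1`. -/
theorem HasLipschitzBoundary.volume_frontier (hL : HasLipschitzBoundary Ω)
    (ho : IsOpen Ω) (hb : Bornology.IsBounded Ω) : volume (frontier Ω) = 0 := by
  have := hL.isFiniteMeasure_surface ho hb
  have hfin : Measure.euclideanHausdorffMeasure n (frontier Ω) ≠ ∞ := by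
    have h := measure_ne_top (surface (frontier Ω)) univ
    rwa [surface, Measure.restrict_apply_univ] at h
  have h := (Measure.euclideanHausdorffMeasure_zero_or_top n.lt_succ_self
    (frontier Ω)).resolve_right hfin
  rwa [EuclideanSpace.euclideanHausdorffMeasure_eq_volume] at h

/-- Bounded continuous functions have integrable normal components. -/
theorem HasLipschitzBoundary.integrable_inner_outwardNormal (hL : HasLipschitzBoundary Ω)
    (ho : IsOpen Ω) (hb : Bornology.IsBounded Ω) {Ψ : Space n → Space n}
    (hΨ : ContinuousOn Ψ (closure Ω)) :
    Integrable (fun x => inner ℝ (Ψ x) (outwardNormal Ω x)) (surface (frontier Ω)) := by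
  have := hL.isFiniteMeasure_surface ho hb
  have hm : AEStronglyMeasurable Ψ (surface (frontier Ω)) :=
    (hΨ.mono frontier_subset_closure).aestronglyMeasurable isClosed_frontier.measurableSet
  obtain ⟨B, hB⟩ := hb.isCompact_closure.exists_bound_of_continuousOn hΨ
  refine Integrable.of_bound (hm.inner (hL.aestronglyMeasurable_outwardNormal ho hb)) (|B| * 1) ?_
  refine (ae_restrict_iff' isClosed_frontier.measurableSet).2 (Eventually.of_forall fun x hx => ?_)
  refine (norm_inner_le_norm _ _).trans ?_
  gcongr
  · exact (hB x (frontier_subset_closure hx)).trans (le_abs_self B)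
  · exact norm_outwardNormal_le Ω x

/-- **Divergence theorem** on a bounded Lipschitz domain, in a constant direction. -/
theorem HasLipschitzBoundary.integral_fderiv_eq (hL : HasLipschitzBoundary Ω) (ho : IsOpen Ω)
    (hb : Bornology.IsBounded Ω) (hF : HasBoundedGradient Ω F M) (e : Space n) :
    ∫ x in Ω, fderiv ℝ F x e =
      ∫ x, F x * inner ℝ e (outwardNormal Ω x) ∂(surface (frontier Ω)) := by
  have hK := hb.isCompact_closure
  -- The identity holds for cutoffs supported near any given point; a partition of unity and
  -- linearity then glue.
  have hloc : ∀ x : closure Ω, ∃ W, IsOpen W ∧ (x : Space n) ∈ W ∧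
      ∀ χ : Space n → ℝ, ContDiff ℝ 1 χ → HasCompactSupport χ → tsupport χ ⊆ W →
        ∫ x in Ω, fderiv ℝ (fun y => χ y * F y) x e =
          ∫ x, χ x * F x * inner ℝ e (outwardNormal Ω x) ∂(surface (frontier Ω)) := by
    intro x
    by_cases hx : (x : Space n) ∈ Ω
    · refine ⟨Ω, ho, hx, fun χ hχ hχc hsub => ?_⟩
      rw [hF.integral_fderiv_cutoff_eq_zero hb hχ hχc hsub]
      refine (integral_eq_zero_of_ae ?_).symm
      refine (ae_restrict_iff' isClosed_frontier.measurableSet).2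
        (Eventually.of_forall fun y hy => ?_)
      have : y ∉ tsupport χ := fun h => by
        rw [ho.frontier_eq] at hy
        exact hy.2 (hsub h)
      simp [image_eq_zero_of_notMem_tsupport this]
    · have hxf : (x : Space n) ∈ frontier Ω := by
        rw [ho.frontier_eq]; exact ⟨x.2, hx⟩
      obtain ⟨L, g, K, W, hc, hxW, hWb⟩ := hL.exists_isBoundaryChart ho hxf
      exact ⟨W, hc.isOpen, hxW, fun χ hχ hχc hsub =>
        hc.integral_fderiv_cutoff_eq hF hb hχ hχc hsub e⟩
  choose W hWo hxW hW using hloc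
  -- Intersecting with balls gives the functions of the partition compact support.
  have hWb : ∀ x, IsOpen (W x ∩ Metric.ball (x : Space n) 1) := fun x =>
    (hWo x).inter Metric.isOpen_ball
  obtain ⟨t, ht⟩ := hK.elim_finite_subcover _ hWb fun x hx =>
    mem_iUnion.2 ⟨⟨x, hx⟩, hxW _, Metric.mem_ball_self one_pos⟩
  obtain ⟨ρ, hρ⟩ := SmoothPartitionOfUnity.exists_isSubordinate (modelWithCornersSelf ℝ (Space n))
    (s := closure Ω) isClosed_closure (fun x : t => W x ∩ Metric.ball (x : Space n) 1)
    (fun x => hWb x) (by simpa only [iUnion_coe_set, iUnion_subtype] using ht)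
  have hρ1 : ∀ i, ContDiff ℝ 1 (ρ i) := fun i => (ρ i).contMDiff.contDiff.of_le (by simp)
  have hρc : ∀ i, HasCompactSupport (ρ i) := fun i =>
    Metric.isCompact_of_isClosed_isBounded (isClosed_tsupport _)
      (Metric.isBounded_ball.subset ((hρ i).trans inter_subset_right))
  have hρs : ∀ i, tsupport (ρ i) ⊆ W i := fun i => (hρ i).trans inter_subset_left
  have hsum : ∀ x ∈ closure Ω, F x = ∑ i, ρ i x * F x := fun x hx => by
    rw [← Finset.sum_mul, ← finsum_eq_sum_of_fintype, ρ.sum_eq_one hx, one_mul]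
  have hgrad : ∀ i, ∃ M', HasBoundedGradient Ω (fun y => ρ i y * F y) M' := fun i => by
    obtain ⟨M', B', h⟩ := hF.exists_cutoff_bounds hb (hρ1 i) (hρc i)
    exact ⟨M', (hρ1 i).continuous.continuousOn.mul hF.continuousOn,
      fun x hx => (h x fun _ => hx).1, fun x hx => (h x fun _ => hx).2.1⟩
  choose M' hM' using hgrad
  calc ∫ x in Ω, fderiv ℝ F x e = ∫ x in Ω, ∑ i, fderiv ℝ (fun y => ρ i y * F y) x e := by
        refine setIntegral_congr_fun ho.measurableSet fun x hx => ?_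
        have h1 : F =ᶠ[𝓝 x] fun y => ∑ i, ρ i y * F y := by
          filter_upwards [ho.mem_nhds hx] with y hy using hsum y (subset_closure hy)
        rw [h1.fderiv_eq, fderiv_fun_sum fun i _ => (hM' i).differentiableAt x hx,
          _root_.sum_apply]
    _ = ∑ i, ∫ x in Ω, fderiv ℝ (fun y => ρ i y * F y) x e :=
        integral_finsetSum _ fun i _ => (hM' i).integrableOn_fderiv ho hb e
    _ = ∑ i, ∫ x, ρ i x * F x * inner ℝ e (outwardNormal Ω x) ∂(surface (frontier Ω)) :=
        Finset.sum_congr rfl fun i _ => hW i _ (hρ1 i) (hρc i) (hρs i)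
    _ = ∫ x, ∑ i, ρ i x * F x * inner ℝ e (outwardNormal Ω x) ∂(surface (frontier Ω)) := by
        refine (integral_finsetSum _ fun i _ => ?_).symm
        have := hL.integrable_inner_outwardNormal ho hb
          (Ψ := fun x => (ρ i x * F x) • e) ((hM' i).continuousOn.smul continuousOn_const)
        simpa only [inner_smul_left, conj_trivial] using this
    _ = ∫ x, F x * inner ℝ e (outwardNormal Ω x) ∂(surface (frontier Ω)) := by
        refine integral_congr_ae ((ae_restrict_iff' isClosed_frontier.measurableSet).2
          (Eventually.of_forall fun x hx => ?_))
        simp only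
        rw [← Finset.sum_mul, ← hsum x (frontier_subset_closure hx)]

/-- **Divergence theorem** on a bounded Lipschitz domain. -/
theorem HasLipschitzBoundary.integral_divergence_eq (hL : HasLipschitzBoundary Ω) (ho : IsOpen Ω)
    (hb : Bornology.IsBounded Ω) {Ψ : Space n → Space n} {M : Fin (n + 1) → ℝ}
    (hΨ : ∀ i, HasBoundedGradient Ω (fun x => Ψ x i) (M i)) :
    ∫ x in Ω, ∑ i, fderiv ℝ (fun y => Ψ y i) x (EuclideanSpace.single i 1) =
      ∫ x, inner ℝ (Ψ x) (outwardNormal Ω x) ∂(surface (frontier Ω)) := by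
  rw [integral_finsetSum _ fun i _ => (hΨ i).integrableOn_fderiv ho hb _,
    Finset.sum_congr rfl fun i _ => hL.integral_fderiv_eq ho hb (hΨ i) _,
    ← integral_finsetSum]
  · refine integral_congr_ae (Eventually.of_forall fun x => ?_)
    simp [PiLp.inner_apply, mul_comm]
  · intro i _
    have := hL.integrable_inner_outwardNormal ho hb
      (Ψ := fun x => Ψ x i • EuclideanSpace.single i (1 : ℝ))
      ((hΨ i).continuousOn.smul continuousOn_const)
    simpa only [inner_smul_left, conj_trivial] using this

end Divergence

end Overset

namespace Overset

/-! ### Fields that are smooth up to the boundary -/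

section Fields

/-- The derivative of a function that is `C¹` on a set is bounded on compact subsets, at interior
points of the set. -/
theorem exists_bound_fderiv_of_contDiffOn {E F : Type*} [NormedAddCommGroup E] [NormedSpace ℝ E]
    [NormedAddCommGroup F] [NormedSpace ℝ F] {f : E → F} {S K : Set E} (hf : ContDiffOn ℝ 1 f S)
    (hK : IsCompact K) (hKS : K ⊆ S) :
    ∃ M, ∀ p ∈ K, p ∈ interior S → ‖fderiv ℝ f p‖ ≤ M := by
  refine hK.induction_on (p := fun s => ∃ M, ∀ p ∈ s, p ∈ interior S → ‖fderiv ℝ f p‖ ≤ M)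
    ⟨0, by simp⟩ (fun s t hst ⟨M, hM⟩ => ⟨M, fun p hp => hM p (hst hp)⟩) ?_ ?_
  · rintro s t ⟨M, hM⟩ ⟨M', hM'⟩
    refine ⟨max M M', fun p hp hpS => ?_⟩
    rcases hp with hp | hp
    · exact (hM p hp hpS).trans (le_max_left _ _)
    · exact (hM' p hp hpS).trans (le_max_right _ _)
  · intro p hp
    have hpS := hKS hp
    have h := hf p hpS
    -- Near `p` there is a derivative `f'` within a neighbourhood in `S`, continuous at `p`. At
    -- interior points of `S` it is the true derivative, so `‖f' p‖ + 1` is a local bound.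
    rw [show (1 : WithTop ℕ∞) = 0 + 1 by simp,
      contDiffWithinAt_succ_iff_hasFDerivWithinAt (by simp)] at h
    obtain ⟨u, hu, -, f', hf', hf'c⟩ := h
    rw [insert_eq_of_mem hpS] at hu
    have hpu : p ∈ u := mem_of_mem_nhdsWithin hpS hu
    obtain ⟨V, hVo, hpV, hVu⟩ := mem_nhdsWithin.1 hu
    have hb : ∀ᶠ q in 𝓝[u] p, ‖f' q‖ < ‖f' p‖ + 1 :=
      hf'c.continuousWithinAt.norm.eventually (gt_mem_nhds (lt_add_one _))
    obtain ⟨V', hVo', hpV', hVu'⟩ := mem_nhdsWithin.1 hb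
    refine ⟨V ∩ V', mem_nhdsWithin_of_mem_nhds ((hVo.inter hVo').mem_nhds ⟨hpV, hpV'⟩),
      ‖f' p‖ + 1, fun q hq hqS => ?_⟩
    have hqu : q ∈ u := hVu ⟨hq.1, interior_subset hqS⟩
    have hnhds : u ∈ 𝓝 q := by
      filter_upwards [hVo.mem_nhds hq.1, isOpen_interior.mem_nhds hqS] with z hz hz'
      exact hVu ⟨hz, interior_subset hz'⟩
    rw [((hf' q hqu).hasFDerivAt hnhds).fderiv]
    exact le_of_lt (hVu' ⟨hq.2, hqu⟩)

/-- Integrals of continuous fields against a bounded density depend continuously on time. -/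
theorem continuousOn_integral_inner {X E : Type*} [TopologicalSpace X] [MeasurableSpace X]
    [OpensMeasurableSpace X] [NormedAddCommGroup E] [InnerProductSpace ℝ E]
    [SecondCountableTopology E] {μ : Measure X} [IsFiniteMeasure μ] {A : Set X} (hA : IsCompact A)
    (hAm : MeasurableSet A) (hμ : ∀ᵐ x ∂μ, x ∈ A) {I : Set ℝ} (hI : IsCompact I)
    {Ψ : ℝ → X → E} (hΨ : ContinuousOn (Function.uncurry Ψ) (I ×ˢ A)) {ν : X → E}
    (hν : AEStronglyMeasurable ν μ) (hν1 : ∀ x, ‖ν x‖ ≤ 1) :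
    ContinuousOn (fun t => ∫ x, inner ℝ (Ψ t x) (ν x) ∂μ) I := by
  borelize E
  obtain ⟨B, hB⟩ := (hI.prod hA).exists_bound_of_continuousOn hΨ
  have hcont : ∀ t ∈ I, ContinuousOn (Ψ t) A := fun t ht =>
    hΨ.comp (Continuous.continuousOn (by fun_prop)) (f := fun x => (t, x)) fun x hx => ⟨ht, hx⟩
  refine continuousOn_of_dominated (bound := fun _ => |B| * 1) ?_ ?_ (integrable_const _) ?_
  · intro t ht
    have h := (hcont t ht).aestronglyMeasurable (μ := μ) hAm
    rw [Measure.restrict_eq_self_of_ae_mem hμ] at h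
    exact h.inner hν
  · intro t ht
    filter_upwards [hμ] with x hx
    refine (norm_inner_le_norm _ _).trans ?_
    gcongr
    · exact (hB (t, x) ⟨ht, hx⟩).trans (le_abs_self B)
    · exact hν1 x
  · filter_upwards [hμ] with x hx
    have : ContinuousOn (fun t => Ψ t x) I :=
      hΨ.comp (Continuous.continuousOn (by fun_prop)) (f := fun t => (t, x)) fun t ht => ⟨ht, hx⟩
    exact this.inner continuousOn_const

variable {n : ℕ} {D : Set (Space n)} {T : ℝ} {q : ℝ → Space n → ℝ}

theorem mem_interior_Ioo_prod_closure (ho : IsOpen D) {t : ℝ} (ht : t ∈ Ioo 0 T) {x : Space n}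
    (hx : x ∈ D) : (t, x) ∈ interior (Ioo 0 T ×ˢ closure D) := by
  rw [interior_prod_eq, interior_Ioo]
  exact ⟨ht, interior_maximal subset_closure ho hx⟩

/-- The field is `C¹` up to the boundary in space but only for open times, hence the compact time
interval. -/
theorem exists_bound_fderiv_uncurry (ho : IsOpen D) (hb : Bornology.IsBounded D)
    (hq : ContDiffOn ℝ 1 (Function.uncurry q) (Ioo 0 T ×ˢ closure D)) {a b : ℝ}
    (hab : Icc a b ⊆ Ioo 0 T) :
    ∃ M, ∀ t ∈ Icc a b, ∀ x ∈ D, ‖fderiv ℝ (Function.uncurry q) (t, x)‖ ≤ M := by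
  obtain ⟨M, hM⟩ := exists_bound_fderiv_of_contDiffOn hq
    (isCompact_Icc.prod hb.isCompact_closure) (prod_mono hab subset_rfl)
  exact ⟨M, fun t ht x hx => hM (t, x) ⟨ht, subset_closure hx⟩
    (mem_interior_Ioo_prod_closure ho (hab ht) hx)⟩

theorem differentiableAt_uncurry {F : Type*} [NormedAddCommGroup F] [NormedSpace ℝ F]
    {q : ℝ → Space n → F} (ho : IsOpen D)
    (hq : ContDiffOn ℝ 1 (Function.uncurry q) (Ioo 0 T ×ˢ closure D)) {t : ℝ} (ht : t ∈ Ioo 0 T)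
    {x : Space n} (hx : x ∈ D) : DifferentiableAt ℝ (Function.uncurry q) (t, x) :=
  (hq.contDiffAt (mem_interior_iff_mem_nhds.1
    (mem_interior_Ioo_prod_closure ho ht hx))).differentiableAt one_ne_zero

theorem hasDerivAt_time {F : Type*} [NormedAddCommGroup F] [NormedSpace ℝ F]
    {q : ℝ → Space n → F} {t : ℝ} {x : Space n}
    (h : DifferentiableAt ℝ (Function.uncurry q) (t, x)) :
    HasDerivAt (fun τ => q τ x) (fderiv ℝ (Function.uncurry q) (t, x) (1, 0)) t :=
  HasFDerivAt.comp_hasDerivAt (f := fun τ => (τ, x)) t h.hasFDerivAt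
    ((hasDerivAt_id t).prodMk (hasDerivAt_const t x))

theorem hasFDerivAt_space {F : Type*} [NormedAddCommGroup F] [NormedSpace ℝ F]
    {q : ℝ → Space n → F} {t : ℝ} {x : Space n}
    (h : DifferentiableAt ℝ (Function.uncurry q) (t, x)) :
    HasFDerivAt (q t) (fderiv ℝ (Function.uncurry q) (t, x) ∘L
      ContinuousLinearMap.inr ℝ ℝ (Space n)) x :=
  HasFDerivAt.comp (f := fun y => (t, y)) x h.hasFDerivAt (hasFDerivAt_prodMk_right t x)

theorem hasBoundedGradient_of_contDiffOn (ho : IsOpen D) (hb : Bornology.IsBounded D)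
    (hq : ContDiffOn ℝ 1 (Function.uncurry q) (Ioo 0 T ×ˢ closure D)) {t : ℝ}
    (ht : t ∈ Ioo 0 T) : ∃ M, HasBoundedGradient D (q t) M := by
  -- A degenerate time interval suffices for a single time slice.
  obtain ⟨M, hM⟩ := exists_bound_fderiv_uncurry ho hb hq (a := t) (b := t) (by simpa using ht)
  refine ⟨M, ?_, fun x hx => (hasFDerivAt_space
    (differentiableAt_uncurry ho hq ht hx)).differentiableAt, fun x hx => ?_⟩
  · exact hq.continuousOn.comp (Continuous.continuousOn (by fun_prop)) (f := fun x => (t, x))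
      fun x hx => ⟨ht, hx⟩
  · rw [(hasFDerivAt_space (differentiableAt_uncurry ho hq ht hx)).fderiv]
    refine (ContinuousLinearMap.opNorm_comp_le _ _).trans ?_
    exact (mul_le_of_le_one_right (norm_nonneg _) (ContinuousLinearMap.norm_inr_le_one ℝ ℝ _)).trans
      (hM t ⟨le_rfl, le_rfl⟩ x hx)

theorem integrableOn_of_continuousOn_closure (hb : Bornology.IsBounded D) {f : Space n → ℝ}
    (hf : ContinuousOn f (closure D)) : IntegrableOn f D :=
  (hf.integrableOn_compact hb.isCompact_closure).mono_set subset_closure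

theorem ContinuousOn.uncurry_right_closure {F : Type*} [TopologicalSpace F] {I : Set ℝ}
    {q : ℝ → Space n → F} (hq : ContinuousOn (Function.uncurry q) (I ×ˢ closure D)) {t : ℝ}
    (ht : t ∈ I) : ContinuousOn (q t) (closure D) :=
  hq.comp (Continuous.continuousOn (by fun_prop)) (f := fun x => (t, x)) fun x hx => ⟨ht, hx⟩

theorem continuousOn_setIntegral (ho : IsOpen D) (hb : Bornology.IsBounded D)
    (hq : ContinuousOn (Function.uncurry q) (Icc 0 T ×ˢ closure D)) :
    ContinuousOn (fun t => ∫ x in D, q t x) (Icc 0 T) := by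
  have : IsFiniteMeasure (volume.restrict D) := ⟨by simpa using hb.measure_lt_top⟩
  have h := continuousOn_integral_inner (μ := volume.restrict D) hb.isCompact_closure
    isClosed_closure.measurableSet ((ae_restrict_iff' ho.measurableSet).2
      (Eventually.of_forall fun x hx => subset_closure hx)) isCompact_Icc hq
    (ν := fun _ => 1) aestronglyMeasurable_const (by simp)
  simpa using h

/-- Differentiation under the integral sign. -/
theorem hasDerivAt_setIntegral (ho : IsOpen D) (hb : Bornology.IsBounded D)
    (hq : ContDiffOn ℝ 1 (Function.uncurry q) (Ioo 0 T ×ˢ closure D)) {t : ℝ}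
    (ht : t ∈ Ioo 0 T) :
    IntegrableOn (fun x => deriv (fun τ => q τ x) t) D ∧
      HasDerivAt (fun τ => ∫ x in D, q τ x) (∫ x in D, deriv (fun τ => q τ x) t) t := by
  -- On a compact interval around `t` inside `(0, T)` the time derivatives are dominated by a
  -- constant.
  obtain ⟨a, ha0, hat⟩ := exists_between ht.1
  obtain ⟨b, htb, hbT⟩ := exists_between ht.2
  have hab : Icc a b ⊆ Ioo 0 T := fun τ hτ => ⟨ha0.trans_le hτ.1, hτ.2.trans_lt hbT⟩
  obtain ⟨M, hM⟩ := exists_bound_fderiv_uncurry ho hb hq hab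
  have hderiv : ∀ τ ∈ Ioo 0 T, ∀ x ∈ D, HasDerivAt (fun τ => q τ x)
      (fderiv ℝ (Function.uncurry q) (τ, x) (1, 0)) τ := fun τ hτ x hx =>
    hasDerivAt_time (differentiableAt_uncurry ho hq hτ hx)
  have hcont : ∀ τ ∈ Ioo 0 T, ContinuousOn (q τ) (closure D) := fun τ hτ =>
    ContinuousOn.uncurry_right_closure hq.continuousOn hτ
  refine hasDerivAt_integral_of_dominated_loc_of_deriv_le (F := q)
    (F' := fun τ x => deriv (fun τ => q τ x) τ) (μ := volume.restrict D)
    (bound := fun _ => M * ‖((1 : ℝ), (0 : Space n))‖) (Icc_mem_nhds hat htb) ?_ ?_ ?_ ?_ ?_ ?_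
  · filter_upwards [Ioo_mem_nhds ht.1 ht.2] with τ hτ
    exact ((hcont τ hτ).mono subset_closure).aestronglyMeasurable ho.measurableSet
  · exact integrableOn_of_continuousOn_closure hb (hcont t ht)
  · have hm : Measurable fun x => fderiv ℝ (Function.uncurry q) (t, x) (1, 0) :=
      (measurable_fderiv_apply_const ℝ (Function.uncurry q) (1, 0)).comp
        (by fun_prop : Measurable fun x : Space n => (t, x))
    refine hm.aestronglyMeasurable.congr ((ae_restrict_iff' ho.measurableSet).2
      (Eventually.of_forall fun x hx => ?_))
    exact (hderiv t ht x hx).deriv.symm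
  · refine (ae_restrict_iff' ho.measurableSet).2 (Eventually.of_forall fun x hx τ hτ => ?_)
    rw [(hderiv τ (hab hτ) x hx).deriv]
    exact (fderiv ℝ (Function.uncurry q) (τ, x)).le_of_opNorm_le (hM τ hτ x hx) _
  · exact integrableOn_const hb.measure_lt_top.ne
  · refine (ae_restrict_iff' ho.measurableSet).2 (Eventually.of_forall fun x hx τ hτ => ?_)
    exact (hderiv τ (hab hτ) x hx).differentiableAt.hasDerivAt

end Fields

/-! ### Entropy balance on one domain -/

section Balance

variable {n p : ℕ} {law : ConservationLaw n p} {s : State p → ℝ} {fε : State p → Space n}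
  {D Ω : Set (Space n)} {T : ℝ} {u : ℝ → Space n → State p}

/-- Used to restrict both fields to the overlap. -/
theorem IsSmoothField.mono (hu : IsSmoothField law Ω T u) (h : D ⊆ Ω) :
    IsSmoothField law D T u where
  admissible t ht x hx := hu.admissible t ht x (closure_mono h hx)
  continuousOn := hu.continuousOn.mono (prod_mono subset_rfl (closure_mono h))
  contDiffOn := hu.contDiffOn.mono (prod_mono subset_rfl (closure_mono h))

theorem IsSmoothField.continuousOn_comp {F : Type*} [TopologicalSpace F]
    (hu : IsSmoothField law D T u) {h : State p → F} (hh : ContinuousOn h law.admissible) :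
    ContinuousOn (Function.uncurry fun t x => h (u t x)) (Icc 0 T ×ˢ closure D) :=
  hh.comp hu.continuousOn fun z hz => hu.admissible z.1 hz.1 z.2 hz.2

theorem IsSmoothField.contDiffOn_comp {F : Type*} [NormedAddCommGroup F] [NormedSpace ℝ F]
    (hu : IsSmoothField law D T u) {h : State p → F} (hh : ContDiffOn ℝ 1 h law.admissible) :
    ContDiffOn ℝ 1 (Function.uncurry fun t x => h (u t x)) (Ioo 0 T ×ˢ closure D) :=
  hh.comp hu.contDiffOn fun z hz => hu.admissible z.1 (Ioo_subset_Icc_self hz.1) z.2 hz.2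

theorem ConservationLaw.differentiableAt {F : Type*} [NormedAddCommGroup F] [NormedSpace ℝ F]
    (law : ConservationLaw n p) {h : State p → F} (hh : ContDiffOn ℝ 1 h law.admissible)
    {ω : State p} (hω : ω ∈ law.admissible) : DifferentiableAt ℝ h ω :=
  (hh.contDiffAt (law.isOpen_admissible.mem_nhds hω)).differentiableAt one_ne_zero

theorem IsEntropyPair.contDiffOn_entropyFlux_apply (hpair : IsEntropyPair law s fε)
    (i : Fin (n + 1)) : ContDiffOn ℝ 1 (fun ω => fε ω i) law.admissible :=
  (EuclideanSpace.proj (𝕜 := ℝ) i).contDiff.comp_contDiffOn hpair.entropyFlux_contDiffOn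

/-- Contracting the conservation law with the entropy variables gives the entropy equation. -/
theorem IsEntropyPair.inner_residual (hpair : IsEntropyPair law s fε)
    (hu : IsSmoothField law D T u) (ho : IsOpen D) {t : ℝ} (ht : t ∈ Ioo 0 T) {x : Space n}
    (hx : x ∈ D) :
    inner ℝ (entropyVariables s (u t x)) (residual law u t x) =
      deriv (fun τ => s (u τ x)) t +
        ∑ i, fderiv ℝ (fun y => fε (u t y) i) x (EuclideanSpace.single i 1) := by
  have hω := hu.admissible t (Ioo_subset_Icc_self ht) x (subset_closure hx)
  have hd := differentiableAt_uncurry ho hu.contDiffOn ht hx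
  have hut := hasDerivAt_time hd
  have hux := hasFDerivAt_space hd
  rw [residual, inner_add_right, inner_sum]
  congr 1
  · have h := (law.differentiableAt hpair.entropy_contDiffOn hω).hasFDerivAt.comp_hasDerivAt t hut
    have h' : HasDerivAt (fun τ => s (u τ x)) _ t := h
    rw [h'.deriv, hut.deriv, entropyVariables, inner_gradient_left]
  · refine Finset.sum_congr rfl fun i _ => ?_
    have h1 : HasFDerivAt (fun y => law.flux i (u t y)) _ x :=
      (law.differentiableAt (law.flux_contDiffOn i) hω).hasFDerivAt.comp x hux
    have h2 : HasFDerivAt (fun y => fε (u t y) i) _ x :=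
      (law.differentiableAt (hpair.contDiffOn_entropyFlux_apply i) hω).hasFDerivAt.comp x hux
    rw [h1.fderiv, h2.fderiv]
    exact (hpair.contraction _ hω i _).symm

/-- Entropy balance on a bounded Lipschitz domain: the entropy residual is integrable and accounts
for the rate of change of the entropy and for the flux through the boundary. -/
theorem IsEntropyPair.balance (hpair : IsEntropyPair law s fε)
    (hu : IsSmoothField law D T u) (hL : HasLipschitzBoundary D) (ho : IsOpen D)
    (hb : Bornology.IsBounded D) {t : ℝ} (ht : t ∈ Ioo 0 T) :
    IntegrableOn (fun x => inner ℝ (entropyVariables s (u t x)) (residual law u t x)) D ∧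
      HasDerivAt (fun τ => ∫ x in D, s (u τ x))
        ((∫ x in D, inner ℝ (entropyVariables s (u t x)) (residual law u t x)) -
          ∫ x, inner ℝ (fε (u t x)) (outwardNormal D x) ∂(surface (frontier D))) t := by
  obtain ⟨hint, hderiv⟩ := hasDerivAt_setIntegral ho hb
    (hu.contDiffOn_comp hpair.entropy_contDiffOn) ht
  have hgrad : ∀ i, ∃ M, HasBoundedGradient D (fun x => fε (u t x) i) M := fun i =>
    hasBoundedGradient_of_contDiffOn ho hb
      (hu.contDiffOn_comp (hpair.contDiffOn_entropyFlux_apply i)) ht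
  choose M hM using hgrad
  have hdivint : IntegrableOn
      (fun x => ∑ i, fderiv ℝ (fun y => fε (u t y) i) x (EuclideanSpace.single i 1)) D :=
    integrable_finsetSum _ fun i _ => (hM i).integrableOn_fderiv ho hb _
  have hcongr : EqOn (fun x => inner ℝ (entropyVariables s (u t x)) (residual law u t x))
      (fun x => deriv (fun τ => s (u τ x)) t +
        ∑ i, fderiv ℝ (fun y => fε (u t y) i) x (EuclideanSpace.single i 1)) D :=
    fun x hx => hpair.inner_residual hu ho ht hx
  refine ⟨(hint.add hdivint).congr_fun hcongr.symm ho.measurableSet, ?_⟩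
  rw [setIntegral_congr_fun ho.measurableSet hcongr, integral_add hint hdivint,
    hL.integral_divergence_eq ho hb hM, add_sub_cancel_right]
  exact hderiv

end Balance

end Overset

namespace Overset

/-! ### Integrals over unions and differences -/

/-- Integrals over a boundary that consists of two parts. -/
theorem integral_surface_union {n : ℕ} {Γ Γ₁ Γ₂ : Set (Space n)} (hΓ : Γ = Γ₁ ∪ Γ₂)
    (hd : Disjoint Γ₁ Γ₂) (hm : MeasurableSet Γ₂) {h : Space n → ℝ}
    (hh : Integrable h (surface Γ)) :
    ∫ x, h x ∂(surface Γ) = (∫ x, h x ∂(surface Γ₁)) + ∫ x, h x ∂(surface Γ₂) := by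
  subst hΓ
  exact setIntegral_union hd hm (IntegrableOn.mono_set (t := Γ₁ ∪ Γ₂) hh subset_union_left)
    (IntegrableOn.mono_set (t := Γ₁ ∪ Γ₂) hh subset_union_right)

theorem surface_mono {n : ℕ} {Γ Γ' : Set (Space n)} (h : Γ ⊆ Γ') : surface Γ ≤ surface Γ' :=
  Measure.restrict_mono h le_rfl

/-- Removing the closure of a domain with null boundary is removing the intersection. -/
theorem setIntegral_sdiff_closure {n : ℕ} {A B : Set (Space n)} (hA : IsOpen A)
    (hB : IsOpen B) (hnull : volume (frontier B) = 0) {h : Space n → ℝ} (hh : IntegrableOn h A) :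
    ∫ x in A \ closure B, h x = (∫ x in A, h x) - ∫ x in A ∩ B, h x := by
  rw [← setIntegral_sdiff (hA.inter hB).measurableSet hh inter_subset_left]
  refine setIntegral_congr_set ?_
  filter_upwards [measure_eq_zero_iff_ae_notMem.1 hnull] with x hx
  rw [hB.frontier_eq] at hx
  refine propext ⟨fun h => ⟨h.1, fun h' => h.2 (subset_closure h'.2)⟩,
    fun h => ⟨h.1, fun h' => hx ⟨h', fun hxB => h.2 ⟨h.1, hxB⟩⟩⟩⟩

/-! ### The overlap region -/

namespace Geometry

variable {n : ℕ} (G : Geometry n)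

theorem isOpen_overlap : IsOpen G.overlap := G.isOpen_u.inter G.isOpen_v

theorem isBounded_overlap : Bornology.IsBounded G.overlap := G.isBounded_u.subset inter_subset_left

theorem measurableSet_Γa : MeasurableSet G.Γa :=
  isClosed_frontier.measurableSet.diff G.isOpen_v.measurableSet

theorem measurableSet_Γb : MeasurableSet G.Γb :=
  isClosed_frontier.measurableSet.inter G.isOpen_u.measurableSet

theorem measurableSet_Γc : MeasurableSet G.Γc :=
  isClosed_frontier.measurableSet.inter G.isOpen_v.measurableSet

theorem measurableSet_Γd : MeasurableSet G.Γd :=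
  isClosed_frontier.measurableSet.diff G.isOpen_u.measurableSet

theorem frontier_u_eq : frontier G.Ωu = G.Γa ∪ G.Γc := (sdiff_union_inter _ _).symm

theorem frontier_v_eq : frontier G.Ωv = G.Γd ∪ G.Γb := (sdiff_union_inter _ _).symm

/-- A point of the closure of the overlap that is in neither domain would lie on both frontiers,
which do not meet. -/
theorem frontier_overlap_eq : frontier G.overlap = G.Γb ∪ G.Γc := by
  rw [G.isOpen_overlap.frontier_eq]
  ext x
  constructor
  · rintro ⟨hcl, hx⟩
    have hu : x ∈ closure G.Ωu := closure_mono inter_subset_left hcl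
    have hv : x ∈ closure G.Ωv := closure_mono inter_subset_right hcl
    by_cases hxu : x ∈ G.Ωu
    · refine Or.inl ⟨?_, hxu⟩
      rw [G.isOpen_v.frontier_eq]
      exact ⟨hv, fun hxv => hx ⟨hxu, hxv⟩⟩
    · have hfu : x ∈ frontier G.Ωu := by
        rw [G.isOpen_u.frontier_eq]; exact ⟨hu, hxu⟩
      refine Or.inr ⟨hfu, ?_⟩
      by_contra hxv
      refine G.disjoint_frontier.le_bot ⟨hfu, ?_⟩
      rw [G.isOpen_v.frontier_eq]; exact ⟨hv, hxv⟩
  · rintro (⟨hf, hu⟩ | ⟨hf, hv⟩)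
    · rw [G.isOpen_v.frontier_eq] at hf
      exact ⟨G.isOpen_u.inter_closure ⟨hu, hf.1⟩, fun h => hf.2 h.2⟩
    · rw [G.isOpen_u.frontier_eq] at hf
      refine ⟨?_, fun h => hf.2 h.1⟩
      rw [overlap, inter_comm]
      exact G.isOpen_v.inter_closure ⟨hv, hf.1⟩

theorem eventually_mem_overlap_iff_of_mem_Γb {x : Space n} (hx : x ∈ G.Γb) :
    ∀ᶠ y in 𝓝 x, (y ∈ G.overlap ↔ y ∈ G.Ωv) := by
  filter_upwards [G.isOpen_u.mem_nhds hx.2] with y hy using and_iff_right hy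

theorem eventually_mem_overlap_iff_of_mem_Γc {x : Space n} (hx : x ∈ G.Γc) :
    ∀ᶠ y in 𝓝 x, (y ∈ G.overlap ↔ y ∈ G.Ωu) := by
  filter_upwards [G.isOpen_v.mem_nhds hx.2] with y hy using and_iff_left hy

/-- Near each of its boundary points the overlap coincides with one of the two domains, because the
other one is a neighbourhood of the point; so it inherits the charts. -/
theorem lipschitz_overlap : HasLipschitzBoundary G.overlap := by
  intro x hx
  rw [G.frontier_overlap_eq] at hx
  rcases hx with hx | hx
  · obtain ⟨L, g, K, hg, h⟩ := G.lipschitz_v x hx.1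
    refine ⟨L, g, K, hg, ?_⟩
    filter_upwards [h, G.eventually_mem_overlap_iff_of_mem_Γb hx] with y hy hy'
    rw [hy', hy]
  · obtain ⟨L, g, K, hg, h⟩ := G.lipschitz_u x hx.1
    refine ⟨L, g, K, hg, ?_⟩
    filter_upwards [h, G.eventually_mem_overlap_iff_of_mem_Γc hx] with y hy hy'
    rw [hy', hy]

theorem disjoint_Γb_Γc : Disjoint G.Γb G.Γc :=
  G.disjoint_frontier.symm.mono inter_subset_left inter_subset_left

theorem disjoint_Γa_Γc : Disjoint G.Γa G.Γc := disjoint_sdiff_inter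

theorem disjoint_Γd_Γb : Disjoint G.Γd G.Γb := disjoint_sdiff_inter

theorem integral_frontier_u {Ψ : Space n → Space n} (hΨ : ContinuousOn Ψ (closure G.Ωu)) :
    ∫ x, inner ℝ (Ψ x) (outwardNormal G.Ωu x) ∂(surface (frontier G.Ωu)) =
      (∫ x, inner ℝ (Ψ x) (outwardNormal G.Ωu x) ∂(surface G.Γa)) +
        ∫ x, inner ℝ (Ψ x) (outwardNormal G.Ωu x) ∂(surface G.Γc) :=
  integral_surface_union G.frontier_u_eq G.disjoint_Γa_Γc G.measurableSet_Γc
    (G.lipschitz_u.integrable_inner_outwardNormal G.isOpen_u G.isBounded_u hΨ)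

theorem integral_frontier_v {Ψ : Space n → Space n} (hΨ : ContinuousOn Ψ (closure G.Ωv)) :
    ∫ x, inner ℝ (Ψ x) (outwardNormal G.Ωv x) ∂(surface (frontier G.Ωv)) =
      (∫ x, inner ℝ (Ψ x) (outwardNormal G.Ωv x) ∂(surface G.Γd)) +
        ∫ x, inner ℝ (Ψ x) (outwardNormal G.Ωv x) ∂(surface G.Γb) :=
  integral_surface_union G.frontier_v_eq G.disjoint_Γd_Γb G.measurableSet_Γb
    (G.lipschitz_v.integrable_inner_outwardNormal G.isOpen_v G.isBounded_v hΨ)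

/-- By locality the exterior normal of the overlap is `n̂_b` on `Γb` and `n̂_c` on `Γc`. -/
theorem integral_frontier_overlap {Ψ : Space n → Space n}
    (hΨ : ContinuousOn Ψ (closure G.overlap)) :
    ∫ x, inner ℝ (Ψ x) (outwardNormal G.overlap x) ∂(surface (frontier G.overlap)) =
      (∫ x, inner ℝ (Ψ x) (outwardNormal G.Ωv x) ∂(surface G.Γb)) +
        ∫ x, inner ℝ (Ψ x) (outwardNormal G.Ωu x) ∂(surface G.Γc) := by
  rw [integral_surface_union G.frontier_overlap_eq G.disjoint_Γb_Γc G.measurableSet_Γc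
    (G.lipschitz_overlap.integrable_inner_outwardNormal G.isOpen_overlap G.isBounded_overlap hΨ)]
  congr 1
  · refine setIntegral_congr_fun G.measurableSet_Γb fun x hx => ?_
    simp only [outwardNormal_congr (G.eventually_mem_overlap_iff_of_mem_Γb hx)]
  · refine setIntegral_congr_fun G.measurableSet_Γc fun x hx => ?_
    simp only [outwardNormal_congr (G.eventually_mem_overlap_iff_of_mem_Γc hx)]

end Geometry

/-! ### The entropy balance of the overset problem -/

section Main

variable {n p : ℕ} {law : ConservationLaw n p} {s : State p → ℝ} {fε : State p → Space n}
  {G : Geometry n} {η T : ℝ} {Pb : Penalty law G.Γb} {Pc : Penalty law G.Γc}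
  {𝒱 : Submodule ℝ ((Space n → State p) × (Space n → State p))}
  {u v : ℝ → Space n → State p}

/-- The weights `1 - η` and `η` on the overlap are written as `1` minus `η` and `1` minus `1 - η`.
Thus only `Ωu`, `Ωv` and the overlap occur, to which the one-domain balance applies. -/
theorem totalEntropy_eq (hs : ContinuousOn s law.admissible) (hu : IsSmoothField law G.Ωu T u)
    (hv : IsSmoothField law G.Ωv T v) {t : ℝ} (ht : t ∈ Icc 0 T) :
    totalEntropy s G η u v t =
      (∫ x in G.Ωu, s (u t x)) - η * (∫ x in G.overlap, s (u t x)) +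
        (∫ x in G.Ωv, s (v t x)) - (1 - η) * ∫ x in G.overlap, s (v t x) := by
  classical
  have hiu : IntegrableOn (fun x => s (u t x)) G.Ωu :=
    integrableOn_of_continuousOn_closure G.isBounded_u
      (ContinuousOn.uncurry_right_closure (hu.continuousOn_comp hs) ht)
  have hiv : IntegrableOn (fun x => s (v t x)) G.Ωv :=
    integrableOn_of_continuousOn_closure G.isBounded_v
      (ContinuousOn.uncurry_right_closure (hv.continuousOn_comp hs) ht)
  have hmu := G.isOpen_u.measurableSet
  have hmv := G.isOpen_v.measurableSet
  have hmo := G.isOpen_overlap.measurableSet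
  have hmΩ : MeasurableSet G.Ω := hmu.union hmv
  have hiuo : IntegrableOn (fun x => s (u t x)) G.overlap := hiu.mono_set inter_subset_left
  have hivo : IntegrableOn (fun x => s (v t x)) G.overlap := hiv.mono_set inter_subset_right
  have h1 := hiu.integrable_indicator hmu
  have h2 := (hiuo.integrable_indicator hmo).const_mul η
  have h3 := hiv.integrable_indicator hmv
  have h4 := (hivo.integrable_indicator hmo).const_mul (1 - η)
  rw [totalEntropy, ← integral_indicator hmΩ,
    ← integral_indicator hmu, ← integral_indicator hmv, ← integral_indicator hmo,
    ← integral_indicator hmo, ← integral_const_mul, ← integral_const_mul]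
  have h12 : Integrable (fun x => G.Ωu.indicator (fun x => s (u t x)) x -
      η * G.overlap.indicator (fun x => s (u t x)) x) := h1.sub h2
  have h123 : Integrable (fun x => G.Ωu.indicator (fun x => s (u t x)) x -
      η * G.overlap.indicator (fun x => s (u t x)) x +
      G.Ωv.indicator (fun x => s (v t x)) x) := h12.add h3
  rw [← integral_sub h1 h2, ← integral_add h12 h3, ← integral_sub h123 h4]
  refine integral_congr_ae (Eventually.of_forall fun x => ?_)
  by_cases hxu : x ∈ G.Ωu <;> by_cases hxv : x ∈ G.Ωv <;>
    simp [indicator, Geometry.Ω, Geometry.overlap, oversetEntropy, hxu, hxv]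
  ring

/-- The work of the entropy variables against an integrable penalty is integrable. -/
theorem integrable_inner_penalty {Γ D : Set (Space n)} (hΓ : MeasurableSet Γ)
    (hsub : Γ ⊆ closure D) (hb : Bornology.IsBounded D) {φ P : Space n → State p}
    (hφ : ContinuousOn φ (closure D)) (hP : Integrable P (surface Γ)) :
    Integrable (fun x => inner ℝ (φ x) (P x)) (surface Γ) := by
  obtain ⟨B, hB⟩ := hb.isCompact_closure.exists_bound_of_continuousOn hφ
  have hφm : AEStronglyMeasurable φ (surface Γ) := (hφ.mono hsub).aestronglyMeasurable hΓ
  refine (hP.norm.const_mul B).mono' (hφm.inner hP.1) ?_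
  refine (ae_restrict_iff' hΓ).2 (Eventually.of_forall fun x hx => ?_)
  refine (norm_inner_le_norm _ _).trans ?_
  gcongr
  exact hB x (hsub hx)

/-- The interface integral splits into flux differences and penalties. -/
theorem integral_interfaceIntegrand {Γ : Set (Space n)} {P : Penalty law Γ}
    {β ν : Space n → Space n} {c t : ℝ} (hβ : ∀ x, β x = c • ν x)
    (hFu : Integrable (fun x => inner ℝ (fε (u t x)) (ν x)) (surface Γ))
    (hFv : Integrable (fun x => inner ℝ (fε (v t x)) (ν x)) (surface Γ))
    (hPu : Integrable (fun x => inner ℝ (entropyVariables s (u t x)) (P.Pu x (u t x) (v t x)))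
      (surface Γ))
    (hPv : Integrable (fun x => inner ℝ (entropyVariables s (v t x)) (P.Pv x (u t x) (v t x)))
      (surface Γ)) :
    ∫ x, interfaceIntegrand s fε β P u v t x ∂(surface Γ) =
      c * ((∫ x, inner ℝ (fε (u t x)) (ν x) ∂(surface Γ)) -
        ∫ x, inner ℝ (fε (v t x)) (ν x) ∂(surface Γ)) +
      ∫ x, (inner ℝ (entropyVariables s (u t x)) (P.Pu x (u t x) (v t x)) +
        inner ℝ (entropyVariables s (v t x)) (P.Pv x (u t x) (v t x))) ∂(surface Γ) := by
  have hF : Integrable (fun x => c * (inner ℝ (fε (u t x)) (ν x) - inner ℝ (fε (v t x)) (ν x)))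
      (surface Γ) := (hFu.sub hFv).const_mul c
  have hP : Integrable (fun x => inner ℝ (entropyVariables s (u t x)) (P.Pu x (u t x) (v t x)) +
      inner ℝ (entropyVariables s (v t x)) (P.Pv x (u t x) (v t x))) (surface Γ) := hPu.add hPv
  rw [← integral_sub hFu hFv, ← integral_const_mul, ← integral_add hF hP]
  refine integral_congr_ae (Eventually.of_forall fun x => ?_)
  simp only [interfaceIntegrand, hβ, inner_sub_left, inner_smul_right]
  ring

/-- The rate of change of the total entropy. -/
theorem IsSolution.hasDerivAt_totalEntropy (hpair : IsEntropyPair law s fε)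
    (hsol : IsSolution law s G η Pb Pc T 𝒱 u v) {t : ℝ} (ht : t ∈ Ioo 0 T) :
    HasDerivAt (totalEntropy s G η u v)
      (-physicalFlux fε G u v t -
        (∫ x, interfaceIntegrand s fε (G.βb η) Pb u v t x ∂(surface G.Γb)) -
        ∫ x, interfaceIntegrand s fε (G.βc η) Pc u v t x ∂(surface G.Γc)) t := by
  have ht' := Ioo_subset_Icc_self ht
  have hou : G.overlap ⊆ G.Ωu := inter_subset_left
  have hov : G.overlap ⊆ G.Ωv := inter_subset_right
  have hfε := hpair.entropyFlux_contDiffOn.continuousOn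
  obtain ⟨iuu, duu⟩ :=
    hpair.balance hsol.smooth_u G.lipschitz_u G.isOpen_u G.isBounded_u ht
  obtain ⟨iuo, duo⟩ := hpair.balance (hsol.smooth_u.mono hou) G.lipschitz_overlap
    G.isOpen_overlap G.isBounded_overlap ht
  obtain ⟨ivv, dvv⟩ :=
    hpair.balance hsol.smooth_v G.lipschitz_v G.isOpen_v G.isBounded_v ht
  obtain ⟨ivo, dvo⟩ := hpair.balance (hsol.smooth_v.mono hov) G.lipschitz_overlap
    G.isOpen_overlap G.isBounded_overlap ht
  have hcu : ContinuousOn (fun x => fε (u t x)) (closure G.Ωu) :=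
    ContinuousOn.uncurry_right_closure (hsol.smooth_u.continuousOn_comp hfε) ht'
  have hcv : ContinuousOn (fun x => fε (v t x)) (closure G.Ωv) :=
    ContinuousOn.uncurry_right_closure (hsol.smooth_v.continuousOn_comp hfε) ht'
  have hcuo := hcu.mono (closure_mono hou)
  have hcvo := hcv.mono (closure_mono hov)
  have hiu := G.lipschitz_u.integrable_inner_outwardNormal G.isOpen_u G.isBounded_u hcu
  have hiv := G.lipschitz_v.integrable_inner_outwardNormal G.isOpen_v G.isBounded_v hcv
  rw [G.integral_frontier_u hcu] at duu
  rw [G.integral_frontier_v hcv] at dvv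
  rw [G.integral_frontier_overlap hcuo] at duo
  rw [G.integral_frontier_overlap hcvo] at dvo
  have hwt := hsol.test_continuousOn _ (hsol.entropyVariables_mem t ht)
  have hbu : G.Γb ⊆ closure G.Ωu := inter_subset_right.trans subset_closure
  have hbv : G.Γb ⊆ closure G.Ωv := inter_subset_left.trans frontier_subset_closure
  have hcu' : G.Γc ⊆ closure G.Ωu := inter_subset_left.trans frontier_subset_closure
  have hcv' : G.Γc ⊆ closure G.Ωv := inter_subset_right.trans subset_closure
  have hweak := hsol.weakForm t ht _ (hsol.entropyVariables_mem t ht)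
  -- The field `u` is not controlled on all of `∂Ωv`, so integrability of its flux across `Γb` comes
  -- from the frontier of the overlap; similarly for `v` across `Γc`.
  have hov' : IntegrableOn (fun x => inner ℝ (fε (u t x)) (outwardNormal G.overlap x)) G.Γb
      (Measure.euclideanHausdorffMeasure n) := by
    have h := G.lipschitz_overlap.integrable_inner_outwardNormal G.isOpen_overlap
      G.isBounded_overlap hcuo
    exact IntegrableOn.mono_set (t := frontier G.overlap) h
      (G.frontier_overlap_eq ▸ subset_union_left)
  have fub : Integrable (fun x => inner ℝ (fε (u t x)) (outwardNormal G.Ωv x))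
      (surface G.Γb) := by
    refine hov'.congr_fun (fun x hx => ?_) G.measurableSet_Γb
    simp only [outwardNormal_congr (G.eventually_mem_overlap_iff_of_mem_Γb hx)]
  have fvb : Integrable (fun x => inner ℝ (fε (v t x)) (outwardNormal G.Ωv x))
      (surface G.Γb) :=
    IntegrableOn.mono_set (t := frontier G.Ωv) hiv inter_subset_left
  have fuc : Integrable (fun x => inner ℝ (fε (u t x)) (outwardNormal G.Ωu x))
      (surface G.Γc) :=
    IntegrableOn.mono_set (t := frontier G.Ωu) hiu inter_subset_left
  have hov'' : IntegrableOn (fun x => inner ℝ (fε (v t x)) (outwardNormal G.overlap x)) G.Γc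
      (Measure.euclideanHausdorffMeasure n) := by
    have h := G.lipschitz_overlap.integrable_inner_outwardNormal G.isOpen_overlap
      G.isBounded_overlap hcvo
    exact IntegrableOn.mono_set (t := frontier G.overlap) h
      (G.frontier_overlap_eq ▸ subset_union_right)
  have fvc : Integrable (fun x => inner ℝ (fε (v t x)) (outwardNormal G.Ωu x))
      (surface G.Γc) := by
    refine hov''.congr_fun (fun x hx => ?_) G.measurableSet_Γc
    simp only [outwardNormal_congr (G.eventually_mem_overlap_iff_of_mem_Γc hx)]
  rw [integral_interfaceIntegrand (c := -η) (ν := outwardNormal G.Ωv)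
      (fun x => by simp [Geometry.βb]) fub fvb
      (integrable_inner_penalty G.measurableSet_Γb hbu G.isBounded_u hwt.1
        (hsol.integrable_Pbu t ht))
      (integrable_inner_penalty G.measurableSet_Γb hbv G.isBounded_v hwt.2
        (hsol.integrable_Pbv t ht)),
    integral_interfaceIntegrand (c := 1 - η) (ν := outwardNormal G.Ωu)
      (fun x => by simp [Geometry.βc]) fuc fvc
      (integrable_inner_penalty G.measurableSet_Γc hcu' G.isBounded_u hwt.1
        (hsol.integrable_Pcu t ht))
      (integrable_inner_penalty G.measurableSet_Γc hcv' G.isBounded_v hwt.2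
        (hsol.integrable_Pcv t ht)), physicalFlux]
  rw [WeakForm, Geometry.onlyU, Geometry.onlyV,
    setIntegral_sdiff_closure G.isOpen_u G.isOpen_v
      (G.lipschitz_v.volume_frontier G.isOpen_v G.isBounded_v) iuu,
    setIntegral_sdiff_closure G.isOpen_v G.isOpen_u
      (G.lipschitz_u.volume_frontier G.isOpen_u G.isBounded_u) ivv, inter_comm G.Ωv,
    integral_add (iuo.const_mul (1 - η)) (ivo.const_mul η), integral_const_mul,
    integral_const_mul] at hweak
  -- The rewritten weak form contains the residual integrals with these same four coefficients.
  have hder := ((duu.sub (duo.const_mul η)).add dvv).sub (dvo.const_mul (1 - η))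
  have heq : totalEntropy s G η u v =ᶠ[𝓝 t] fun τ =>
      (∫ x in G.Ωu, s (u τ x)) - η * (∫ x in G.overlap, s (u τ x)) +
        (∫ x in G.Ωv, s (v τ x)) - (1 - η) * ∫ x in G.overlap, s (v τ x) := by
    filter_upwards [Ioo_mem_nhds ht.1 ht.2] with τ hτ
    exact totalEntropy_eq hpair.entropy_contDiffOn.continuousOn hsol.smooth_u hsol.smooth_v
      (Ioo_subset_Icc_self hτ)
  refine (hder.congr_of_eventuallyEq heq).congr_deriv ?_
  have hO : G.Ωu ∩ G.Ωv = G.overlap := rfl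
  rw [hO] at hweak
  -- The weak form trades the residuals for the penalties. The remaining fluxes match `β`: on `Γb`
  -- the coefficients are `-η` for `u` and `1 - (1 - η) = η` for `v`, on `Γc` they are `1 - η` and
  -- `-(1 - η)`.
  linear_combination hweak

/-- Continuity at the end points, where no time derivative is assumed, permits integration over the
closed interval. -/
theorem IsSolution.continuousOn_totalEntropy (hpair : IsEntropyPair law s fε)
    (hsol : IsSolution law s G η Pb Pc T 𝒱 u v) :
    ContinuousOn (totalEntropy s G η u v) (Icc 0 T) := by
  have hs := hpair.entropy_contDiffOn.continuousOn
  have hou : G.overlap ⊆ G.Ωu := inter_subset_left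
  have hov : G.overlap ⊆ G.Ωv := inter_subset_right
  have h1 := continuousOn_setIntegral G.isOpen_u G.isBounded_u
    (hsol.smooth_u.continuousOn_comp hs)
  have h2 := continuousOn_setIntegral G.isOpen_overlap G.isBounded_overlap
    ((hsol.smooth_u.mono hou).continuousOn_comp hs)
  have h3 := continuousOn_setIntegral G.isOpen_v G.isBounded_v
    (hsol.smooth_v.continuousOn_comp hs)
  have h4 := continuousOn_setIntegral G.isOpen_overlap G.isBounded_overlap
    ((hsol.smooth_v.mono hov).continuousOn_comp hs)
  refine (((h1.sub (h2.const_smul η)).add h3).sub (h4.const_smul (1 - η))).congr fun t ht => ?_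
  exact totalEntropy_eq hs hsol.smooth_u hsol.smooth_v ht

/-- The flux of a smooth field through part of the boundary is continuous in time. -/
theorem IsSmoothField.continuousOn_flux {D Γ : Set (Space n)} {u : ℝ → Space n → State p}
    (hu : IsSmoothField law D T u) (hfε : ContinuousOn fε law.admissible)
    (hL : HasLipschitzBoundary D) (ho : IsOpen D) (hb : Bornology.IsBounded D)
    (hΓ : MeasurableSet Γ) (hΓD : Γ ⊆ frontier D) :
    ContinuousOn (fun t => ∫ x, inner ℝ (fε (u t x)) (outwardNormal D x) ∂(surface Γ))
      (Icc 0 T) := by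
  have := hL.isFiniteMeasure_surface ho hb
  have hle := surface_mono hΓD
  have : IsFiniteMeasure (surface Γ) := isFiniteMeasure_of_le (surface (frontier D)) hle
  exact continuousOn_integral_inner (μ := surface Γ) hb.isCompact_closure isClosed_closure.measurableSet
    ((ae_restrict_iff' hΓ).2 (Eventually.of_forall fun x hx =>
      frontier_subset_closure (hΓD hx))) isCompact_Icc (hu.continuousOn_comp hfε)
    ((hL.aestronglyMeasurable_outwardNormal ho hb).mono_measure hle)
    (norm_outwardNormal_le D)

theorem IsSolution.continuousOn_physicalFlux (hpair : IsEntropyPair law s fε)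
    (hsol : IsSolution law s G η Pb Pc T 𝒱 u v) :
    ContinuousOn (physicalFlux fε G u v) (Icc 0 T) :=
  (hsol.smooth_u.continuousOn_flux hpair.entropyFlux_contDiffOn.continuousOn G.lipschitz_u
    G.isOpen_u G.isBounded_u G.measurableSet_Γa sdiff_subset).add
  (hsol.smooth_v.continuousOn_flux hpair.entropyFlux_contDiffOn.continuousOn G.lipschitz_v
    G.isOpen_v G.isBounded_v G.measurableSet_Γd sdiff_subset)

/-- Integration of a differential inequality with a continuous right-hand side. -/
theorem le_sub_integral_of_deriv_le {S S' Φ : ℝ → ℝ} (hS : ContinuousOn S (Icc 0 T))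
    (hΦ : ContinuousOn Φ (Icc 0 T)) (hd : ∀ t ∈ Ioo 0 T, HasDerivAt S (S' t) t)
    (hle : ∀ t ∈ Ioo 0 T, S' t ≤ -Φ t) {t : ℝ} (ht : t ∈ Icc 0 T) :
    S t ≤ S 0 - ∫ τ in (0 : ℝ)..t, Φ τ := by
  have h0T : (0 : ℝ) ≤ T := ht.1.trans ht.2
  have hprim : ContinuousOn (fun t => ∫ τ in (0 : ℝ)..t, Φ τ) (Icc 0 T) := by
    have := intervalIntegral.continuousOn_primitive_interval (μ := volume) (f := Φ)
      (a := 0) (b := T) (by rw [uIcc_of_le h0T]; exact hΦ.integrableOn_Icc)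
    rwa [uIcc_of_le h0T] at this
  have hder : ∀ t ∈ Ioo 0 T, HasDerivAt (fun t => S t + ∫ τ in (0 : ℝ)..t, Φ τ)
      (S' t + Φ t) t := fun t ht => by
    refine (hd t ht).add (intervalIntegral.integral_hasDerivAt_right ?_ ?_ ?_)
    · exact (hΦ.mono (Icc_subset_Icc le_rfl ht.2.le)).intervalIntegrable_of_Icc ht.1.le
    · exact (hΦ.mono Ioo_subset_Icc_self).stronglyMeasurableAtFilter isOpen_Ioo t ht
    · exact hΦ.continuousAt (Icc_mem_nhds ht.1 ht.2)
  have hanti : AntitoneOn (fun t => S t + ∫ τ in (0 : ℝ)..t, Φ τ) (Icc 0 T) := by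
    refine antitoneOn_of_deriv_nonpos (convex_Icc 0 T) (hS.add hprim) ?_ ?_ <;>
      rw [interior_Icc]
    · exact fun t ht => (hder t ht).differentiableAt.differentiableWithinAt
    · intro t ht
      rw [(hder t ht).deriv]
      linarith [hle t ht]
  have := hanti ⟨le_rfl, h0T⟩ ht ht.1
  simp only [intervalIntegral.integral_same, add_zero] at this
  linarith

end Main

end Overset

/-! ### The entropy bound and entropy conservation -/

theorem theorem1 {n p : ℕ} (law : Overset.ConservationLaw n p)
    (s : Overset.State p → ℝ) (fε : Overset.State p → Overset.Space n)
    (hpair : Overset.IsEntropyPair law s fε) (G : Overset.Geometry n)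
    (η : ℝ) (hη0 : 0 < η) (hη1 : η < 1)
    (Pb : Overset.Penalty law G.Γb) (Pc : Overset.Penalty law G.Γc)
    (T : ℝ) (hT : 0 < T)
    (𝒱 : Submodule ℝ
      ((Overset.Space n → Overset.State p) × (Overset.Space n → Overset.State p)))
    (u v : ℝ → Overset.Space n → Overset.State p)
    (hsol : Overset.IsSolution law s G η Pb Pc T 𝒱 u v) :
    IntervalIntegrable (Overset.physicalFlux fε G u v) volume 0 T ∧
    (Overset.InterfaceNonneg s fε G η Pb Pc T u v →
      (∀ t ∈ Ioo 0 T, DifferentiableAt ℝ (Overset.totalEntropy s G η u v) t ∧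
        deriv (Overset.totalEntropy s G η u v) t ≤ -Overset.physicalFlux fε G u v t) ∧
      (∀ t ∈ Icc 0 T, Overset.totalEntropy s G η u v t ≤
        Overset.totalEntropy s G η u v 0 -
          ∫ τ in (0 : ℝ)..t, Overset.physicalFlux fε G u v τ)) ∧
    (Overset.EntropyPreserving s fε G η Pb Pc T u v →
      (∀ t ∈ Ioo 0 T, HasDerivAt (Overset.totalEntropy s G η u v)
        (-Overset.physicalFlux fε G u v t) t) ∧
      (∀ t ∈ Icc 0 T, Overset.totalEntropy s G η u v t =
        Overset.totalEntropy s G η u v 0 -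
          ∫ τ in (0 : ℝ)..t, Overset.physicalFlux fε G u v τ)) := by
  have hΦ := hsol.continuousOn_physicalFlux hpair
  have hS := hsol.continuousOn_totalEntropy hpair
  have hd := fun t ht => hsol.hasDerivAt_totalEntropy hpair (t := t) ht
  refine ⟨hΦ.intervalIntegrable_of_Icc hT.le, fun hB => ?_, fun hB => ?_⟩
  · have hle : ∀ t ∈ Ioo 0 T, -Overset.physicalFlux fε G u v t -
        (∫ x, Overset.interfaceIntegrand s fε (G.βb η) Pb u v t x ∂(Overset.surface G.Γb)) -
        (∫ x, Overset.interfaceIntegrand s fε (G.βc η) Pc u v t x ∂(Overset.surface G.Γc)) ≤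
        -Overset.physicalFlux fε G u v t := fun t ht => by
      linarith [integral_nonneg_of_ae (hB t ht).1, integral_nonneg_of_ae (hB t ht).2]
    exact ⟨fun t ht => ⟨(hd t ht).differentiableAt, (hd t ht).deriv.trans_le (hle t ht)⟩,
      fun t ht => Overset.le_sub_integral_of_deriv_le hS hΦ hd hle ht⟩
  · have hd' : ∀ t ∈ Ioo 0 T, HasDerivAt (Overset.totalEntropy s G η u v)
        (-Overset.physicalFlux fε G u v t) t := fun t ht => by
      have h := hd t ht
      rwa [integral_eq_zero_of_ae (hB t ht).1, integral_eq_zero_of_ae (hB t ht).2, sub_zero,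
        sub_zero] at h
    refine ⟨hd', fun t ht => le_antisymm
      (Overset.le_sub_integral_of_deriv_le hS hΦ hd' (fun t _ => le_rfl) ht) ?_⟩
    -- The reverse inequality is the same integration applied to the negatives of the entropy and of
    -- the flux.
    have h := Overset.le_sub_integral_of_deriv_le hS.neg hΦ.neg (fun t ht => (hd' t ht).neg)
      (fun t _ => le_rfl) ht
    simp only [Pi.neg_apply, intervalIntegral.integral_neg] at h
    linarith
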